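/- Let $0<p<1$, $q=1-p$, $p\neq q$. Let $\xi_1,\xi_2,\dots$ be i.i.d. with $P(\xi_i=1)=p$, $P(\xi_i=0)=q$; let $X_i=-\ln p$ if $\xi_i=1$ and $X_i=-\ln q$ if $\xi_i=0$; put $S_n=\sum_{i=1}^n X_i$ and $\nu(t)=\min\{n: S_n>t\}$. Let $H=-p\ln p-q\ln q$, $H_2=p\ln^2p+q\ln^2q$ and $\hat\sigma^2=(H_2-H^2)/H^3$, with $\hat\sigma=\sqrt{\hat\sigma^2}$. For real $V$ and a non-negative integer $K$ let $V_2=V\ln 2$ and $D=(K+1)\wedge\nu(V_2)$. Let $\Phi$ be the standard normal distribution function, $\Psi(x)=\int_{-\infty}^x\Phi(y)\,dy$, and $Z\sim N(0,1)$. Write $\{x\}=x-\lfloor x\rfloor$. **Theorem.** We have $\hat\sigma^2>0$. Suppose that $V,K\to\infty$ (along an arbitrary sequence or, more generally, filter). Then: 1. If $(K-V_2/H)/\sqrt{V_2}\to+\infty$, then $(D-V_2/H)/\sqrt{\hat\sigma^2V_2}\to N(0,1)$ in distribution, and $\operatorname{Var}(D)\sim\hat\sigma^2V_2$. 2. If $(K-V_2/H)/\sqrt{V_2}\to-\infty$,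 then $P(D=K+1)\to1$, and $\operatorname{Var}(D)=o(V_2)$. 3. If $(K-V_2/H)/\sqrt{V_2}\to a\in(-\infty,\infty)$, then $(D-V_2/H)/\sqrt{V_2}\to(\hat\sigma Z)\wedge a=\hat\sigma\,(Z\wedge(a/\hat\sigma))$ in distribution, and $\operatorname{Var}(D)\sim V_2\operatorname{Var}((\hat\sigma Z)\wedge a)=V_2\hat\sigma^2\operatorname{Var}(Z\wedge(a/\hat\sigma))$. 4. In every case, $$E D=\frac{V_2}{H}-\hat\sigma\sqrt{V_2}\,\Psi\!\left(\frac{V_2/H-K}{\hat\sigma\sqrt{V_2}}\right)+o(\sqrt{V_2})=K-\hat\sigma\sqrt{V_2}\,\Psi\!\left(\frac{K-V_2/H}{\hat\sigma\sqrt{V_2}}\right)+o(\sqrt{V_2}).$$ 5. If eventually $(K-V_2/H)/\sqrt{V_2}\ge\ln V_2$, then $$E D=\frac{V_2}{H}+\frac{H_2}{2H^2}+\psi(V_2)+o(1),$$ where $\psi=0$ if $\ln p/\ln q$ is irrational, and $\psi(t)=\frac dH\left(\frac12-\{t/d\}\right)$ if $\ln p/\ln q$ is rational, $d$ being the largest positive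 real number such that $\ln p$ and $\ln q$ are both integer multiples of $d$. 6. If eventually $(K-V_2/H)/\sqrt{V_2}\le-\ln V_2$, then $E D=K+1+o(1)$. -/

import Mathlib

open MeasureTheory ProbabilityTheory Filter Topology Asymptotics

namespace StoppedWalk

/-- The probability of a single letter: `true` is the letter `1`, `false` is the letter `0`. -/
noncomputable def letterProb (p : ℝ) (b : Bool) : ℝ := if b then p else 1 - p

/-- `S n = X₁ + ⋯ + Xₙ` where the `X`'s are minus the logarithms of the probabilities of the
letters; the letters `ξ₁, ξ₂, …` are indexed from `0`. -/
noncomputable def walk {Ω : Type*} (p : ℝ) (ξ : ℕ → Ω → Bool) (n : ℕ) (ω : Ω) : ℝ :=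
  ∑ i ∈ Finset.range n, -Real.log (letterProb p (ξ i ω))

/-- `ν(t) = min {n : S n > t}`. For `0 < p < 1` the steps are bounded below by a positive constant,
so the set is nonempty for every `ω`. -/
noncomputable def firstPassage {Ω : Type*} (p : ℝ) (ξ : ℕ → Ω → Bool) (t : ℝ) (ω : Ω) : ℕ :=
  sInf {n : ℕ | t < walk p ξ n ω}

/-- The exit time `D = (K + 1) ∧ ν(V ln 2)`. -/
noncomputable def exitTime {Ω : Type*} (p : ℝ) (ξ : ℕ → Ω → Bool) (V : ℝ) (K : ℕ) (ω : Ω) : ℕ :=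
  min (K + 1) (firstPassage p ξ (V * Real.log 2) ω)

/-- `H₂ = p ln² p + q ln² q`, with `q = 1 - p`. -/
noncomputable def secondMoment (p : ℝ) : ℝ :=
  p * Real.log p ^ 2 + (1 - p) * Real.log (1 - p) ^ 2

/-- `(H₂ - H²) / H³`, where `H = -p ln p - q ln q` is the entropy. -/
noncomputable def sigmaHatSq (p : ℝ) : ℝ :=
  (secondMoment p - Real.binEntropy p ^ 2) / Real.binEntropy p ^ 3

noncomputable def sigmaHat (p : ℝ) : ℝ := Real.sqrt (sigmaHatSq p)

/-- `Ψ(x) = ∫_{-∞}^x Φ(y) dy`, with `Φ` the standard normal distribution function. -/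
noncomputable def Psi (x : ℝ) : ℝ := ∫ y in Set.Iic x, cdf (gaussianReal 0 1) y

/-- The steps are `d`-arithmetic: `d` is the largest positive real number such that both values
`-ln p` and `-ln q` of a step are integer multiples of `d`. -/
def IsSpan (p d : ℝ) : Prop :=
  IsGreatest {e : ℝ | 0 < e ∧ (∃ m : ℤ, -Real.log p = m * e) ∧ ∃ n : ℤ, -Real.log (1 - p) = n * e} d

/-- `(d / H) (1 / 2 - {t / d})`, with `{·}` the fractional part. -/
noncomputable def oscillation (p d t : ℝ) : ℝ :=
  d / Real.binEntropy p * (1 / 2 - Int.fract (t / d))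

/-- If `ln p / ln q = a / b` in lowest terms, then the span is `|ln p| / a`. -/
theorem isSpan_of_ratio {p : ℝ} (h0 : 0 < p) (h1 : p < 1) {a b : ℕ} (ha : 0 < a) (hb : 0 < b)
    (hab : a.Coprime b) (h : Real.log p / Real.log (1 - p) = a / b) :
    IsSpan p (|Real.log p| / a) := by
  have hp : Real.log p < 0 := Real.log_neg h0 h1
  have hq : Real.log (1 - p) < 0 := Real.log_neg (by linarith) (by linarith)
  have ha' : (0 : ℝ) < a := by exact_mod_cast ha
  have hb' : (0 : ℝ) < b := by exact_mod_cast hb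
  rw [div_eq_div_iff hq.ne hb'.ne'] at h
  rw [abs_of_neg hp]
  refine ⟨⟨by apply div_pos <;> linarith, ⟨a, ?_⟩, ⟨b, ?_⟩⟩, ?_⟩
  · push_cast; field_simp
  · push_cast; field_simp; linarith
  · rintro e ⟨he, ⟨m, hm⟩, ⟨n, hn⟩⟩
    have hmpos : 0 < m := by
      have : (0 : ℝ) < m := by
        by_contra hc
        nlinarith
      exact_mod_cast this
    have hmn : m * b = a * n := by
      have h2 : (m * b : ℝ) * e = (a * n : ℝ) * e := by nlinarith
      exact_mod_cast mul_right_cancel₀ he.ne' h2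
    have hdvd : (a : ℤ) ∣ m :=
      (Int.isCoprime_iff_gcd_eq_one.mpr (by simpa using hab)).dvd_of_dvd_mul_right ⟨n, hmn⟩
    have hle : (a : ℝ) ≤ m := by exact_mod_cast Int.le_of_dvd hmpos hdvd
    rw [le_div_iff₀ ha', hm]
    nlinarith

end StoppedWalk

/-! Write `t` for `V₂`, `q` for `1 - p` and `M n = S n - n H`. Subtracting `t / H` and dividing by
`√t` is increasing, so it turns `D` into `min (W t) r`, where `W t = (ν(t) - t / H) / √t` and `r =
(K + 1 - t / H) / √t`. The distributional limits, the variances and the first-order mean therefore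
follow from one fact (`tendstoSq_normPassage`): `W t` tends to `σ̂ Z` in distribution and its second
moments converge too. The squares are then uniformly integrable, and truncation at levels tending to
`+∞`, to a real `a`, or to `-∞` passes to the limit.

That fact comes from `H (ν - n) = (S_ν - n H) - M_ν` with `n = ⌊t / H⌋`. The overshoot `S_ν - t` is
bounded, and Wald's second identity, applied to the bounded transform with coefficients `1{k < ν} -
1{k < n}`, gives `E (M_ν - M_n)² = Var(X) E|ν - n|`. This is `O(√t)`, so after division by `√t` one
may replace `M_ν` by `M_n`, to which the classical central limit theorem applies.

For the mean, `E min (σ̂ Z) r` is an explicit expression in `Ψ`. No convergence of `r` is assumed,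
so `tendsto_integral_min_sub` passes to ultrafilters, along which `r` converges in `[-∞, ∞]`.

When the deadline is `√t log t` away from `t / H`, Hoeffding's inequality bounds the probability of
the unlikely alternative by `exp (-κ log² t)`, which beats the linear size of `ν`. Thus `E D` is `E
ν(t) + o(1)` or `K + 1 + o(1)`.

The constant term of `E ν(t)` is the renewal theorem, proved directly. The function `f(t) = E ν(t) -
t / H` satisfies `f(t) = p f(t - α) + q f(t - β)` for `t ≥ 0`, where `α`, `β` are the two step
sizes, and `p ∫_{t-α}^t f + q ∫_{t-β}^t f` does not depend on `t`. Where `f` is near its limsup it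
is also near it at the translates by `-(iα + jβ)`; these fill a whole window up to a small error, so
the limsup cannot exceed the conserved mean. The same holds for `-f`. In the arithmetic case one
first adds `(d / H) {t / d}`, which makes `f` constant on the cells of the lattice `dℤ`. -/

namespace StoppedWalk

/-! ### Steps of the walk and their moments. -/

/-- The step of the walk produced by the letter `b`. -/
noncomputable def step (p : ℝ) (b : Bool) : ℝ := -Real.log (letterProb p b)

noncomputable def minStep (p : ℝ) : ℝ := min (step p true) (step p false)

noncomputable def maxStep (p : ℝ) : ℝ := max (step p true) (step p false)

theorem step_true (p : ℝ) : step p true = -Real.log p := by simp [step, letterProb]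

theorem step_false (p : ℝ) : step p false = -Real.log (1 - p) := by simp [step, letterProb]

theorem minStep_le_step (p : ℝ) (b : Bool) : minStep p ≤ step p b := by
  cases b
  · exact min_le_right _ _
  · exact min_le_left _ _

theorem step_le_maxStep (p : ℝ) (b : Bool) : step p b ≤ maxStep p := by
  cases b
  · exact le_max_right _ _
  · exact le_max_left _ _

/-- A step weighs `e^{-step}`, so the losses `p⁻¹` and `(1 - p)⁻¹` of the renewal argument multiply
to the exponential of the total displacement. -/
theorem exp_step_true {p : ℝ} (hp0 : 0 < p) : Real.exp (step p true) = p⁻¹ := by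
  rw [step_true, Real.exp_neg, Real.exp_log hp0]

theorem exp_step_false {p : ℝ} (hp1 : p < 1) : Real.exp (step p false) = (1 - p)⁻¹ := by
  rw [step_false, Real.exp_neg, Real.exp_log (by linarith)]

section Steps

variable {p : ℝ} (hp0 : 0 < p) (hp1 : p < 1)

include hp0 hp1

theorem step_pos (b : Bool) : 0 < step p b := by
  cases b
  · rw [step_false]; linarith [Real.log_neg (x := 1 - p) (by linarith) (by linarith)]
  · rw [step_true]; linarith [Real.log_neg hp0 hp1]

theorem minStep_pos : 0 < minStep p := lt_min (step_pos hp0 hp1 _) (step_pos hp0 hp1 _)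

theorem maxStep_pos : 0 < maxStep p := lt_max_of_lt_left (step_pos hp0 hp1 _)

theorem entropy_pos : 0 < Real.binEntropy p := Real.binEntropy_pos hp0 hp1

end Steps

theorem binEntropy_eq_step (p : ℝ) :
    Real.binEntropy p = p * step p true + (1 - p) * step p false := by
  rw [Real.binEntropy_eq_negMulLog_add_negMulLog_one_sub, step_true, step_false]
  simp only [Real.negMulLog]; ring

theorem secondMoment_eq_step (p : ℝ) :
    secondMoment p = p * step p true ^ 2 + (1 - p) * step p false ^ 2 := by
  rw [secondMoment, step_true, step_false]; ring

/-- The variance of a step. -/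
noncomputable def stepVar (p : ℝ) : ℝ := secondMoment p - Real.binEntropy p ^ 2

theorem stepVar_eq (p : ℝ) :
    stepVar p = p * (1 - p) * (step p true - step p false) ^ 2 := by
  rw [stepVar, secondMoment_eq_step, binEntropy_eq_step]; ring

theorem stepVar_eq_centered (p : ℝ) :
    stepVar p = p * (step p true - Real.binEntropy p) ^ 2
      + (1 - p) * (step p false - Real.binEntropy p) ^ 2 := by
  rw [stepVar, secondMoment_eq_step, binEntropy_eq_step]; ring

/-- The logarithm is injective, so `p ≠ q` makes the two step values distinct. -/
theorem stepVar_pos {p : ℝ} (hp0 : 0 < p) (hp1 : p < 1) (hpq : p ≠ 1 - p) : 0 < stepVar p := by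
  rw [stepVar_eq]
  have h : step p true - step p false ≠ 0 := by
    rw [step_true, step_false]
    intro h
    exact hpq (Real.log_injOn_pos (Set.mem_Ioi.2 hp0) (Set.mem_Ioi.2 (by linarith)) (by linarith))
  have : 0 < 1 - p := by linarith
  positivity

/-! ### Pathwise properties of the first passage time. -/

section Passage

variable {Ω : Type*} {p : ℝ} {ξ : ℕ → Ω → Bool} {ω : Ω} {t : ℝ} {n : ℕ}

theorem walk_eq_sum_step : walk p ξ n ω = ∑ i ∈ Finset.range n, step p (ξ i ω) := rfl

@[simp] theorem walk_zero : walk p ξ 0 ω = 0 := by simp [walk]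

theorem walk_succ : walk p ξ (n + 1) ω = walk p ξ n ω + step p (ξ n ω) := by
  simp [walk_eq_sum_step, Finset.sum_range_succ]

theorem mul_minStep_le_walk : n * minStep p ≤ walk p ξ n ω := by
  rw [walk_eq_sum_step, ← nsmul_eq_mul]
  simpa using Finset.card_nsmul_le_sum (Finset.range n) (fun i => step p (ξ i ω)) (minStep p)
    fun i _ => minStep_le_step p _

/-- A deterministic upper bound for the passage time. -/
noncomputable def passageBound (p t : ℝ) : ℕ := ⌊t / minStep p⌋₊ + 1

variable (hp0 : 0 < p) (hp1 : p < 1)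

include hp0 hp1

theorem walk_strictMono : StrictMono fun n => walk p ξ n ω :=
  strictMono_nat_of_lt_succ fun n => by
    rw [walk_succ]; linarith [step_pos hp0 hp1 (ξ n ω)]

theorem lt_walk_of_passageBound_le (hn : passageBound p t ≤ n) : t < walk p ξ n ω := by
  have hm := minStep_pos hp0 hp1
  refine lt_of_lt_of_le ?_ (mul_minStep_le_walk (p := p))
  rw [← div_lt_iff₀ hm]
  refine (Nat.lt_floor_add_one _).trans_le ?_
  exact_mod_cast hn

theorem lt_firstPassage_iff : n < firstPassage p ξ t ω ↔ walk p ξ n ω ≤ t := by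
  have hne : {n : ℕ | t < walk p ξ n ω}.Nonempty :=
    ⟨_, lt_walk_of_passageBound_le hp0 hp1 le_rfl⟩
  constructor
  · intro h
    simpa using Nat.notMem_of_lt_sInf h
  · intro h
    by_contra hc
    have h1 : t < walk p ξ (firstPassage p ξ t ω) ω := Nat.sInf_mem hne
    have h2 : walk p ξ _ ω ≤ walk p ξ n ω := (walk_strictMono hp0 hp1).monotone (not_lt.1 hc)
    linarith

theorem lt_walk_firstPassage : t < walk p ξ (firstPassage p ξ t ω) ω := by
  by_contra h
  exact lt_irrefl _ ((lt_firstPassage_iff hp0 hp1).2 (not_lt.1 h))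

theorem firstPassage_le_passageBound : firstPassage p ξ t ω ≤ passageBound p t := by
  by_contra h
  have h1 := (lt_firstPassage_iff hp0 hp1).1 (not_le.1 h)
  have h2 := lt_walk_of_passageBound_le (ξ := ξ) (ω := ω) hp0 hp1 (le_refl (passageBound p t))
  linarith

theorem walk_firstPassage_le (ht : 0 ≤ t) :
    walk p ξ (firstPassage p ξ t ω) ω ≤ t + maxStep p := by
  have h0 : 0 < firstPassage p ξ t ω := (lt_firstPassage_iff hp0 hp1).2 (by simpa)
  obtain ⟨k, hk⟩ := Nat.exists_eq_succ_of_ne_zero h0.ne'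
  have h1 : walk p ξ k ω ≤ t := (lt_firstPassage_iff hp0 hp1).1 (by omega)
  rw [hk, Nat.succ_eq_add_one, walk_succ]
  linarith [step_le_maxStep p (ξ k ω)]

theorem passageBound_le (ht : 0 ≤ t) : (passageBound p t : ℝ) ≤ t / minStep p + 1 := by
  rw [passageBound]; push_cast
  gcongr
  exact Nat.floor_le (div_nonneg ht (minStep_pos hp0 hp1).le)

/-- The walk increases strictly, so `ν(t)` counts the times `k` with `S k ≤ t`. The deterministic
bound makes the sum finite, and the `k`-th indicator depends on the first `k` letters only. -/
theorem firstPassage_eq_sum {N : ℕ} (hN : passageBound p t ≤ N) :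
    (firstPassage p ξ t ω : ℝ) =
      ∑ k ∈ Finset.range N, if walk p ξ k ω ≤ t then (1 : ℝ) else 0 := by
  have h : ∀ k, (walk p ξ k ω ≤ t) = (k < firstPassage p ξ t ω) := fun k =>
    propext (lt_firstPassage_iff hp0 hp1).symm
  simp only [h, Finset.sum_boole]
  congr 1
  have : Finset.filter (fun k => k < firstPassage p ξ t ω) (Finset.range N)
      = Finset.range (firstPassage p ξ t ω) := by
    ext k
    have := firstPassage_le_passageBound (ξ := ξ) (ω := ω) (t := t) hp0 hp1
    simp only [Finset.mem_filter, Finset.mem_range]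
    omega
  rw [this, Finset.card_range]

end Passage

/-! ### Functions of finitely many letters and Wald's second identity. -/

/-- The letters `ξ 0, ξ 1, …` are independent and each is `true` with probability `p`. -/
structure IsLetterSeq {Ω : Type*} [MeasurableSpace Ω] (P : Measure Ω) (p : ℝ)
    (ξ : ℕ → Ω → Bool) : Prop where
  pos : 0 < p
  lt_one : p < 1
  meas : ∀ i, Measurable (ξ i)
  indep : iIndepFun ξ P
  law : ∀ i, P {ω | ξ i ω = true} = ENNReal.ofReal p

/-- `f ω` is determined by the first `n` letters of `ω`. -/
def PrefixDetermined {Ω : Type*} (ξ : ℕ → Ω → Bool) (n : ℕ) (f : Ω → ℝ) : Prop :=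
  ∀ ω ω', (∀ i < n, ξ i ω = ξ i ω') → f ω = f ω'

section Prefix

variable {Ω : Type*} {ξ : ℕ → Ω → Bool} {n : ℕ} {f g : Ω → ℝ}

/-- Prefix dependence replaces adaptedness to a filtration: such a function factors through a finite
discrete space, which yields measurability, boundedness and independence from later letters. -/
theorem PrefixDetermined.exists_eq_comp (hf : PrefixDetermined ξ n f) :
    ∃ φ : (Finset.range n → Bool) → ℝ, f = φ ∘ fun ω i => ξ i ω := by
  refine (Function.factorsThrough_iff f).1 fun ω ω' h => hf ω ω' fun i hi => ?_
  exact congrFun h ⟨i, Finset.mem_range.2 hi⟩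

theorem PrefixDetermined.mono (hf : PrefixDetermined ξ n f) {m : ℕ} (hm : n ≤ m) :
    PrefixDetermined ξ m f := fun ω ω' h => hf ω ω' fun i hi => h i (hi.trans_le hm)

theorem PrefixDetermined.comp₂ (hf : PrefixDetermined ξ n f) (hg : PrefixDetermined ξ n g)
    (F : ℝ → ℝ → ℝ) : PrefixDetermined ξ n fun ω => F (f ω) (g ω) := fun ω ω' h => by
  simp only [hf ω ω' h, hg ω ω' h]

theorem PrefixDetermined.comp (hf : PrefixDetermined ξ n f) (F : ℝ → ℝ) :
    PrefixDetermined ξ n fun ω => F (f ω) := hf.comp₂ hf fun x _ => F x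

theorem prefixDetermined_const (c : ℝ) : PrefixDetermined ξ n fun _ => c := fun _ _ _ => rfl

theorem prefixDetermined_sum_succ {G : ℕ → Bool → Ω → ℝ}
    (hG : ∀ k b, PrefixDetermined ξ k (G k b)) (n : ℕ) :
    PrefixDetermined ξ n fun ω => ∑ k ∈ Finset.range n, G k (ξ k ω) ω := fun ω ω' h => by
  refine Finset.sum_congr rfl fun k hk => ?_
  have hk := Finset.mem_range.1 hk
  rw [h k hk]
  exact hG k _ ω ω' fun i hi => h i (hi.trans hk)

theorem prefixDetermined_walk (p : ℝ) : PrefixDetermined ξ n (walk p ξ n) :=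
  prefixDetermined_sum_succ (G := fun _ b _ => step p b) (fun _ _ => prefixDetermined_const _) n

variable [MeasurableSpace Ω]

theorem PrefixDetermined.measurable (hf : PrefixDetermined ξ n f) (hξ : ∀ i, Measurable (ξ i)) :
    Measurable f := by
  obtain ⟨φ, rfl⟩ := hf.exists_eq_comp
  exact Measurable.of_discrete.comp (measurable_pi_lambda _ fun i => hξ i)

theorem PrefixDetermined.integrable {P : Measure Ω} [IsFiniteMeasure P]
    (hf : PrefixDetermined ξ n f) (hξ : ∀ i, Measurable (ξ i)) : Integrable f P := by
  have hm := hf.measurable hξ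
  obtain ⟨φ, rfl⟩ := hf.exists_eq_comp
  refine Integrable.of_bound hm.aestronglyMeasurable (∑ x, ‖φ x‖) (ae_of_all _ fun ω => ?_)
  exact Finset.single_le_sum (f := fun x => ‖φ x‖) (fun _ _ => norm_nonneg _) (Finset.mem_univ _)

end Prefix

namespace IsLetterSeq

variable {Ω : Type*} [MeasurableSpace Ω] {P : Measure Ω} [IsProbabilityMeasure P] {p : ℝ}
  {ξ : ℕ → Ω → Bool}

omit [IsProbabilityMeasure P] in
theorem measurableSet_letter (h : IsLetterSeq P p ξ) (i : ℕ) (b : Bool) :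
    MeasurableSet {ω | ξ i ω = b} := h.meas i (measurableSet_singleton b)

theorem prob_eq (h : IsLetterSeq P p ξ) (i : ℕ) (b : Bool) :
    P.real {ω | ξ i ω = b} = letterProb p b := by
  have ht : P.real {ω | ξ i ω = true} = p := by
    rw [measureReal_def, h.law i, ENNReal.toReal_ofReal h.pos.le]
  cases b
  · have hc : {ω | ξ i ω = false} = {ω | ξ i ω = true}ᶜ := by ext; simp
    rw [hc, probReal_compl_eq_one_sub (h.measurableSet_letter i true), ht]
    simp [letterProb]
  · simpa [letterProb] using ht

/-- Conditioning on the letter `ξ n`, which is independent of the first `n` letters. -/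
theorem integral_letter (h : IsLetterSeq P p ξ) {n : ℕ} {F : Bool → Ω → ℝ}
    (hF : ∀ b, PrefixDetermined ξ n (F b)) :
    ∫ ω, F (ξ n ω) ω ∂P = p * ∫ ω, F true ω ∂P + (1 - p) * ∫ ω, F false ω ∂P := by
  have key : ∀ b, Integrable (fun ω => F b ω * (if ξ n ω = b then (1 : ℝ) else 0)) P ∧
      ∫ ω, F b ω * (if ξ n ω = b then (1 : ℝ) else 0) ∂P = letterProb p b * ∫ ω, F b ω ∂P := by
    intro b
    have hm := (hF b).measurable h.meas
    have hind : Measurable fun ω => if ξ n ω = b then (1 : ℝ) else 0 :=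
      (Measurable.of_discrete (f := fun x : Bool => if x = b then (1 : ℝ) else 0)).comp (h.meas n)
    refine ⟨((hF b).integrable h.meas).mul_bdd (c := 1) hind.aestronglyMeasurable
      (ae_of_all _ fun ω => by split_ifs <;> simp), ?_⟩
    have hI : IndepFun (F b) (fun ω => if ξ n ω = b then (1 : ℝ) else 0) P := by
      obtain ⟨φ, hφ⟩ := (hF b).exists_eq_comp
      have hdis : Disjoint (Finset.range n) {n} := by simp
      have := (h.indep.indepFun_finset _ _ hdis h.meas).comp (φ := φ)
        (ψ := fun x => if x ⟨n, by simp⟩ = b then (1 : ℝ) else 0)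
        Measurable.of_discrete Measurable.of_discrete
      rw [hφ]
      exact this
    rw [hI.integral_fun_mul_eq_mul_integral hm.aestronglyMeasurable hind.aestronglyMeasurable,
      mul_comm, ← h.prob_eq n b]
    congr 1
    rw [← integral_indicator_one (h.measurableSet_letter n b)]
    simp [Set.indicator_apply]
  have hsplit : ∀ ω, F (ξ n ω) ω = F true ω * (if ξ n ω = true then (1 : ℝ) else 0)
      + F false ω * (if ξ n ω = false then (1 : ℝ) else 0) := fun ω => by
    cases ξ n ω <;> simp
  simp_rw [hsplit]
  rw [integral_add (key true).1 (key false).1, (key true).2, (key false).2]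
  simp [letterProb]

/-- Second moment of a martingale transform of the centered walk. -/
theorem integral_sq_transform (h : IsLetterSeq P p ξ) {c : ℕ → Ω → ℝ}
    (hc : ∀ k, PrefixDetermined ξ k (c k)) (n : ℕ) :
    ∫ ω, (∑ k ∈ Finset.range n, c k ω * (step p (ξ k ω) - Real.binEntropy p)) ^ 2 ∂P
      = stepVar p * ∑ k ∈ Finset.range n, ∫ ω, c k ω ^ 2 ∂P := by
  have hA : ∀ n, PrefixDetermined ξ n
      fun ω => ∑ k ∈ Finset.range n, c k ω * (step p (ξ k ω) - Real.binEntropy p) :=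
    prefixDetermined_sum_succ (G := fun k b ω => c k ω * (step p b - Real.binEntropy p))
      fun k b => (hc k).comp (· * _)
  induction n with
  | zero => simp
  | succ n ih =>
    rw [Finset.sum_range_succ, mul_add, ← ih]
    simp_rw [Finset.sum_range_succ]
    set A : Ω → ℝ := fun ω => ∑ k ∈ Finset.range n, c k ω * (step p (ξ k ω) - Real.binEntropy p)
    have hstep := h.integral_letter (n := n)
      (F := fun b ω => (A ω + c n ω * (step p b - Real.binEntropy p)) ^ 2)
      fun b => (hA n).comp₂ (hc n) fun x y => (x + y * (step p b - Real.binEntropy p)) ^ 2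
    refine hstep.trans ?_
    have hi : ∀ b, Integrable (fun ω => (A ω + c n ω * (step p b - Real.binEntropy p)) ^ 2) P :=
      fun b => ((hA n).comp₂ (hc n)
        fun x y => (x + y * (step p b - Real.binEntropy p)) ^ 2).integrable h.meas
    have hi1 : Integrable (fun ω => A ω ^ 2) P := ((hA n).comp (· ^ 2)).integrable h.meas
    have hi2 : Integrable (fun ω => c n ω ^ 2) P := ((hc n).comp (· ^ 2)).integrable h.meas
    rw [← integral_const_mul, ← integral_const_mul, ← integral_const_mul,
      ← integral_add ((hi true).const_mul _) ((hi false).const_mul _),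
      ← integral_add hi1 (hi2.const_mul _)]
    -- Averaging over the new letter kills the cross term, since its centered step has mean zero,
    -- and leaves `stepVar p` times the squared coefficient.
    congr 1
    ext ω
    rw [stepVar_eq_centered, binEntropy_eq_step]
    ring

/-- The centered walk. -/
noncomputable def centered {Ω : Type*} (p : ℝ) (ξ : ℕ → Ω → Bool) (n : ℕ) (ω : Ω) : ℝ :=
  walk p ξ n ω - n * Real.binEntropy p

theorem centered_eq_sum {Ω : Type*} (p : ℝ) (ξ : ℕ → Ω → Bool) (n : ℕ) (ω : Ω) :
    centered p ξ n ω = ∑ k ∈ Finset.range n, (step p (ξ k ω) - Real.binEntropy p) := by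
  simp [centered, walk_eq_sum_step]

theorem sum_indicator_lt {N n : ℕ} (hn : n ≤ N) (f : ℕ → ℝ) :
    ∑ k ∈ Finset.range N, (if k < n then (1 : ℝ) else 0) * f k = ∑ k ∈ Finset.range n, f k := by
  simp only [ite_mul, one_mul, zero_mul]
  rw [← Finset.sum_filter]
  congr 1
  ext k
  simp only [Finset.mem_filter, Finset.mem_range]
  omega

omit [IsProbabilityMeasure P] in
theorem measurable_firstPassage (h : IsLetterSeq P p ξ) (t : ℝ) :
    Measurable fun ω => (firstPassage p ξ t ω : ℝ) := by
  simp_rw [firstPassage_eq_sum h.pos h.lt_one le_rfl]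
  refine Finset.measurable_sum _ fun k _ => ?_
  exact ((prefixDetermined_walk p).comp fun x => if x ≤ t then (1 : ℝ) else 0).measurable h.meas

theorem integral_firstPassage (h : IsLetterSeq P p ξ) {t : ℝ} {N : ℕ} (hN : passageBound p t ≤ N) :
    ∫ ω, (firstPassage p ξ t ω : ℝ) ∂P =
      ∑ k ∈ Finset.range N, P.real {ω | walk p ξ k ω ≤ t} := by
  simp_rw [firstPassage_eq_sum h.pos h.lt_one hN]
  rw [integral_finsetSum]
  · refine Finset.sum_congr rfl fun k _ => ?_
    rw [← integral_indicator_one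
      (measurableSet_le ((prefixDetermined_walk p).measurable h.meas) measurable_const)]
    rfl
  · exact fun k _ =>
      ((prefixDetermined_walk p).comp fun x => if x ≤ t then (1 : ℝ) else 0).integrable h.meas

/-- Wald's second identity for the difference between `ν(t)` and a fixed time. -/
theorem integral_sq_centered_firstPassage_sub (h : IsLetterSeq P p ξ) (t : ℝ) (n : ℕ) :
    ∫ ω, (centered p ξ (firstPassage p ξ t ω) ω - centered p ξ n ω) ^ 2 ∂P
      = stepVar p * ∫ ω, |(firstPassage p ξ t ω : ℝ) - n| ∂P := by
  set N := max (passageBound p t) n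
  -- The coefficient is `1{k < ν} - 1{k < n}`, written so as to be visibly determined by the first
  -- `k` letters. Its values are `-1, 0, 1` with constant sign along a path, so its squares sum to
  -- `|ν - n|`.
  set c : ℕ → Ω → ℝ := fun k ω => (if walk p ξ k ω ≤ t then 1 else 0) - if k < n then 1 else 0
  have hc : ∀ k, PrefixDetermined ξ k (c k) := fun k =>
    (prefixDetermined_walk p).comp fun x => (if x ≤ t then 1 else 0) - if k < n then 1 else 0
  have hν : ∀ ω, firstPassage p ξ t ω ≤ N := fun ω =>
    (firstPassage_le_passageBound h.pos h.lt_one).trans (le_max_left _ _)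
  have hc' : ∀ k ω, c k ω =
      (if k < firstPassage p ξ t ω then 1 else 0) - if k < n then 1 else 0 := fun k ω => by
    simp only [c, lt_firstPassage_iff h.pos h.lt_one]
  have h1 : ∀ ω, centered p ξ (firstPassage p ξ t ω) ω - centered p ξ n ω =
      ∑ k ∈ Finset.range N, c k ω * (step p (ξ k ω) - Real.binEntropy p) := fun ω => by
    rw [centered_eq_sum, centered_eq_sum, ← sum_indicator_lt (hν ω),
      ← sum_indicator_lt (le_max_right (passageBound p t) n), ← Finset.sum_sub_distrib]
    exact Finset.sum_congr rfl fun k _ => by rw [hc', sub_mul]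
  have h2 : ∀ ω, |(firstPassage p ξ t ω : ℝ) - n| = ∑ k ∈ Finset.range N, c k ω ^ 2 := fun ω => by
    have hsum : ∀ m ≤ N, ∑ k ∈ Finset.range N, (if k < m then (1 : ℝ) else 0) = m :=
      fun m hm => by simpa using sum_indicator_lt hm fun _ => 1
    rcases le_total n (firstPassage p ξ t ω) with hle | hle
    · rw [abs_of_nonneg (by simpa using hle), ← hsum _ (hν ω), ← hsum n (le_max_right _ _),
        ← Finset.sum_sub_distrib]
      refine Finset.sum_congr rfl fun k _ => ?_
      rw [hc']
      by_cases hk1 : k < n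
      · simp [hk1, hk1.trans_le hle]
      · by_cases hk2 : k < firstPassage p ξ t ω <;> simp [hk1, hk2]
    · rw [abs_of_nonpos (by simpa using hle), neg_sub, ← hsum _ (hν ω), ← hsum n (le_max_right _ _),
        ← Finset.sum_sub_distrib]
      refine Finset.sum_congr rfl fun k _ => ?_
      rw [hc']
      by_cases hk1 : k < firstPassage p ξ t ω
      · simp [hk1, hk1.trans_le hle]
      · by_cases hk2 : k < n <;> simp [hk1, hk2]
  simp_rw [h1, h2]
  rw [h.integral_sq_transform hc, integral_finsetSum]
  exact fun k _ => ((hc k).comp (· ^ 2)).integrable h.meas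

omit [IsProbabilityMeasure P] in
theorem prefixDetermined_centered_firstPassage (h : IsLetterSeq P p ξ) (t : ℝ) :
    PrefixDetermined ξ (passageBound p t)
      fun ω => centered p ξ (firstPassage p ξ t ω) ω := fun ω ω' hω => by
  have hν : firstPassage p ξ t ω = firstPassage p ξ t ω' := by
    have : (firstPassage p ξ t ω : ℝ) = firstPassage p ξ t ω' := by
      rw [firstPassage_eq_sum h.pos h.lt_one le_rfl, firstPassage_eq_sum h.pos h.lt_one le_rfl]
      refine Finset.sum_congr rfl fun k hk => ?_
      rw [(prefixDetermined_walk p).mono (Finset.mem_range.1 hk).le ω ω' hω]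
    exact_mod_cast this
  simp only [centered]
  rw [← hν, (prefixDetermined_walk p).mono (firstPassage_le_passageBound h.pos h.lt_one) ω ω' hω]

theorem memLp_centered (h : IsLetterSeq P p ξ) (n : ℕ) : MemLp (centered p ξ n) 2 P := by
  have hd : PrefixDetermined ξ n (centered p ξ n) :=
    (prefixDetermined_walk p).comp fun x => x - n * Real.binEntropy p
  exact (memLp_two_iff_integrable_sq (hd.measurable h.meas).aestronglyMeasurable).2
    ((hd.comp (· ^ 2)).integrable h.meas)

theorem memLp_centered_firstPassage (h : IsLetterSeq P p ξ) (t : ℝ) :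
    MemLp (fun ω => centered p ξ (firstPassage p ξ t ω) ω) 2 P := by
  have hd := h.prefixDetermined_centered_firstPassage t
  exact (memLp_two_iff_integrable_sq (hd.measurable h.meas).aestronglyMeasurable).2
    ((hd.comp (· ^ 2)).integrable h.meas)

theorem integral_sq_centered (h : IsLetterSeq P p ξ) (n : ℕ) :
    ∫ ω, centered p ξ n ω ^ 2 ∂P = n * stepVar p := by
  have := h.integral_sq_transform (c := fun _ _ => 1) (fun _ => prefixDetermined_const _) n
  simp only [one_mul, one_pow, integral_const, probReal_univ, smul_eq_mul, mul_one,
    Finset.sum_const, Finset.card_range, nsmul_eq_mul] at this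
  simp_rw [centered_eq_sum]
  rw [this, mul_comm]

end IsLetterSeq

/-! ### A renewal theorem for two-step harmonic functions. -/

/-- If `e > 0` lies in the group generated by `α, β > 0`, then the points `iα + jβ` with natural
coefficients eventually meet every half-open interval of length `e`. -/
theorem exists_natComb_mem_Ioc {α β e : ℝ} (hβ : 0 < β) (he : 0 < e) {m n : ℤ}
    (hmn : e = m * α + n * β) :
    ∃ L : ℝ, ∀ x, L ≤ x → ∃ i j : ℕ, i * α + j * β ∈ Set.Ioc (x - e) x := by
  obtain ⟨k, hk⟩ := exists_nat_ge (β / e)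
  -- From this base point one adds `β` until the remainder is below `β`, then adds `e = mα + nβ` at
  -- most `k` times. The reserve `k|m|`, `k|n|` keeps both coefficients nonnegative.
  refine ⟨k * (|m| : ℤ) * α + k * (|n| : ℤ) * β, fun x hx => ?_⟩
  set L : ℝ := k * (|m| : ℤ) * α + k * (|n| : ℤ) * β
  set j := ⌊(x - L) / β⌋₊
  set r := x - L - j * β
  have hj : (j : ℝ) ≤ (x - L) / β := Nat.floor_le (div_nonneg (by linarith) hβ.le)
  have hj' : (x - L) / β < j + 1 := Nat.lt_floor_add_one _
  rw [le_div_iff₀ hβ] at hj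
  rw [div_lt_iff₀ hβ] at hj'
  have hr0 : 0 ≤ r := by simp only [r]; linarith
  have hr1 : r < β := by simp only [r]; linarith
  set i := ⌊r / e⌋₊
  have hi : (i : ℝ) ≤ r / e := Nat.floor_le (div_nonneg hr0 he.le)
  have hi' : r / e < i + 1 := Nat.lt_floor_add_one _
  have hik : (i : ℤ) ≤ k := by
    have : (i : ℝ) ≤ k := hi.trans ((div_le_div_of_nonneg_right hr1.le he.le).trans hk)
    exact_mod_cast this
  rw [le_div_iff₀ he] at hi
  rw [div_lt_iff₀ he] at hi'
  have hnn : ∀ z : ℤ, 0 ≤ (k : ℤ) * |z| + i * z := fun z => by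
    nlinarith [neg_abs_le z, abs_nonneg z, mul_nonneg (sub_nonneg.2 hik) (abs_nonneg z)]
  have hI : (((k * |m| + i * m).toNat : ℕ) : ℝ) = ((k * |m| + i * m : ℤ) : ℝ) := by
    exact_mod_cast congrArg (Int.cast (R := ℝ)) (Int.toNat_of_nonneg (hnn m))
  have hJ : (((k * |n| + i * n).toNat : ℕ) : ℝ) = ((k * |n| + i * n : ℤ) : ℝ) := by
    exact_mod_cast congrArg (Int.cast (R := ℝ)) (Int.toNat_of_nonneg (hnn n))
  refine ⟨(k * |m| + i * m).toNat, (k * |n| + i * n).toNat + j, ?_⟩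
  have hval : (((k * |m| + i * m).toNat : ℕ) : ℝ) * α
      + (((k * |n| + i * n).toNat + j : ℕ) : ℝ) * β = L + i * e + j * β := by
    rw [Nat.cast_add, hI, hJ, hmn]
    simp only [L]
    push_cast
    ring
  rw [hval]
  simp only [r] at hi hi'
  constructor <;> linarith

/-- Data of a two-step renewal equation, the step `α` having weight `p = e^{-α}` and the step `β`
weight `1 - p = e^{-β}`. -/
structure IsHarmonic (p α β : ℝ) (f : ℝ → ℝ) : Prop where
  eq : ∀ t, 0 ≤ t → f t = p * f (t - α) + (1 - p) * f (t - β)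
  bdd : ∃ B, ∀ t, 0 ≤ t → |f t| ≤ B
  integrable : ∀ a b, IntervalIntegrable f volume a b

theorem IsHarmonic.neg {p α β : ℝ} {f : ℝ → ℝ} (hf : IsHarmonic p α β f) :
    IsHarmonic p α β fun t => -f t where
  eq t ht := by rw [hf.eq t ht]; ring
  bdd := by simpa using hf.bdd
  integrable a b := (hf.integrable a b).neg

section Harmonic

variable {p α β : ℝ}

/-- Integrating the renewal equation over `[0, t]` shows that this window functional is conserved.
It fixes the only possible limit in terms of the values of `f` on the negative axis. -/
theorem IsHarmonic.integral_window {f : ℝ → ℝ} (hf : IsHarmonic p α β f) {t : ℝ} (ht : 0 ≤ t) :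
    p * (∫ s in (t - α)..t, f s) + (1 - p) * (∫ s in (t - β)..t, f s) =
      p * (∫ s in (-α)..0, f s) + (1 - p) * ∫ s in (-β)..0, f s := by
  have hI := hf.integrable
  have h1 : ∫ s in (0:ℝ)..t, f s =
      p * (∫ s in (-α)..(t - α), f s) + (1 - p) * ∫ s in (-β)..(t - β), f s := by
    have hc : ∫ s in (0:ℝ)..t, f s =
        ∫ s in (0:ℝ)..t, (p * f (s - α) + (1 - p) * f (s - β)) := by
      refine intervalIntegral.integral_congr fun s hs => ?_
      rw [Set.uIcc_of_le ht] at hs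
      exact hf.eq s hs.1
    have hs : ∀ c : ℝ, IntervalIntegrable (fun s => f (s - c)) volume 0 t := fun c => by
      simpa using (hI (0 - c) (t - c)).comp_sub_right c
    rw [hc, intervalIntegral.integral_add ((hs α).const_mul _) ((hs β).const_mul _),
      intervalIntegral.integral_const_mul, intervalIntegral.integral_const_mul,
      intervalIntegral.integral_comp_sub_right, intervalIntegral.integral_comp_sub_right,
      zero_sub, zero_sub]
  have h2 : ∀ c : ℝ, ∫ s in (t - c)..t, f s =
      (∫ s in (-c)..0, f s) + (∫ s in (0:ℝ)..t, f s) - ∫ s in (-c)..(t - c), f s := fun c => by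
    rw [intervalIntegral.integral_add_adjacent_intervals (hI _ _) (hI _ _), eq_sub_iff_add_eq,
      add_comm, intervalIntegral.integral_add_adjacent_intervals (hI _ _) (hI _ _)]
  rw [h2 α, h2 β]
  linear_combination h1

variable (hp0 : 0 < p) (hp1 : p < 1) (hα : 0 < α) (hβ : 0 < β)

include hp0 hp1 hα hβ

/-- Harmonicity transports an upper bound backwards along the steps. -/
theorem gap_sub_le (hpα : Real.exp α = p⁻¹) (hpβ : Real.exp β = (1 - p)⁻¹) {f : ℝ → ℝ}
    (hf : ∀ t, 0 ≤ t → f t = p * f (t - α) + (1 - p) * f (t - β)) {T C : ℝ} (hT : 0 ≤ T)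
    (hC : ∀ t, T ≤ t → f t ≤ C) (i j : ℕ) {t : ℝ} (ht : T + α + β + i * α + j * β ≤ t) :
    C - f (t - (i * α + j * β)) ≤ (C - f t) * Real.exp (i * α + j * β) := by
  have h1p : 0 < 1 - p := by linarith
  -- The gap `C - f s` is the weighted mean of two nonnegative gaps, so it is at least `p` times the
  -- first of them.
  have stepα : ∀ s, T + α + β ≤ s → C - f (s - α) ≤ (C - f s) * Real.exp α := fun s hs => by
    have h1 := hC (s - β) (by linarith)
    rw [hpα, ← div_eq_mul_inv, le_div_iff₀ hp0, hf s (by linarith)]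
    nlinarith
  have stepβ : ∀ s, T + α + β ≤ s → C - f (s - β) ≤ (C - f s) * Real.exp β := fun s hs => by
    have h1 := hC (s - α) (by linarith)
    rw [hpβ, ← div_eq_mul_inv, le_div_iff₀ h1p, hf s (by linarith)]
    nlinarith
  have hiter : ∀ c : ℝ, 0 < c → (∀ s, T + α + β ≤ s → C - f (s - c) ≤ (C - f s) * Real.exp c) →
      ∀ (k : ℕ) (s : ℝ), T + α + β + k * c ≤ s →
        C - f (s - k * c) ≤ (C - f s) * Real.exp (k * c) := by
    intro c hc hstep k
    induction k with
    | zero => intro s _; simp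
    | succ k ih =>
      intro s hs
      push_cast at hs ⊢
      have h1 := ih s (by linarith)
      have h2 := hstep (s - k * c) (by linarith)
      have e1 : s - (k + 1) * c = s - k * c - c := by ring
      have e2 : (k + 1) * c = k * c + c := by ring
      rw [e1, e2, Real.exp_add, ← mul_assoc]
      exact h2.trans (mul_le_mul_of_nonneg_right h1 (Real.exp_pos c).le)
  have hiα : 0 ≤ i * α := by positivity
  have hjβ : 0 ≤ j * β := by positivity
  have h1 := hiter α hα stepα i t (by linarith)
  have h2 := hiter β hβ stepβ j (t - i * α) (by linarith)
  rw [Real.exp_add, ← mul_assoc, ← sub_sub]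
  exact h2.trans (mul_le_mul_of_nonneg_right h1 (Real.exp_pos _).le)

/-- One half of the renewal theorem: a bounded harmonic function which, up to `δ`, is bounded below
on a window by its values at finitely many backward translates, does not exceed its window mean in
the limit. -/
theorem IsHarmonic.eventually_le (hpα : Real.exp α = p⁻¹) (hpβ : Real.exp β = (1 - p)⁻¹)
    {f : ℝ → ℝ} (hf : IsHarmonic p α β f) {c : ℝ}
    (hc : p * (∫ s in (-α)..0, f s) + (1 - p) * (∫ s in (-β)..0, f s) =
      c * (p * α + (1 - p) * β))
    (hcov : ∀ δ > 0, ∃ L B : ℝ, 0 ≤ L ∧ ∀ t u : ℝ, t - L - max α β ≤ u → u ≤ t - L →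
      ∃ i j : ℕ, i * α + j * β ≤ B ∧ f (t - (i * α + j * β)) - δ ≤ f u)
    {ε : ℝ} (hε : 0 < ε) : ∀ᶠ t in atTop, f t ≤ c + ε := by
  have h1p : 0 < 1 - p := by linarith
  obtain ⟨B₀, hB₀⟩ := hf.bdd
  have hbdd : IsBoundedUnder (· ≤ ·) atTop f := isBoundedUnder_of_eventually_le (a := B₀) <| by
    filter_upwards [eventually_ge_atTop 0] with t ht using (abs_le.1 (hB₀ t ht)).2
  have hcob : IsCoboundedUnder (· ≤ ·) atTop f := by
    refine IsBoundedUnder.isCoboundedUnder_le (isBoundedUnder_of_eventually_ge (a := -B₀) ?_)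
    filter_upwards [eventually_ge_atTop 0] with t ht using (abs_le.1 (hB₀ t ht)).1
  set M := limsup f atTop with hM
  suffices hMc : M ≤ c from
    (eventually_lt_of_limsup_lt (b := c + ε) (by linarith) hbdd).mono fun t ht => ht.le
  by_contra hMc
  push Not at hMc
  obtain ⟨L, B, hL, hLB⟩ := hcov ((M - c) / 4) (by linarith)
  -- A point with `f > M - η` lies at most `2η` below the ceiling `M + η`. Transport over a distance
  -- at most `B` costs a factor `e^B`, giving `(M - c) / 4`; with the slack `δ = (M - c) / 4`, `f`
  -- stays above `(M + c) / 2` on the window.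
  set η := (M - c) / 8 * Real.exp (-B) with hη
  have hη0 : 0 < η := by have : 0 < M - c := by linarith
                         positivity
  obtain ⟨T, hT⟩ := eventually_atTop.1 (eventually_lt_of_limsup_lt (b := M + η) (by linarith) hbdd)
  obtain ⟨t, htf, htT⟩ := ((frequently_lt_of_lt_limsup (b := M - η) hcob (by linarith)).and_eventually
    (eventually_ge_atTop (max T 0 + α + β + |B| + L))).exists
  have hT0 : (0 : ℝ) ≤ max T 0 := le_max_right _ _
  have hlow : ∀ u, t - L - max α β ≤ u → u ≤ t - L → (M + c) / 2 ≤ f u := by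
    intro u hu1 hu2
    obtain ⟨i, j, hij, hfu⟩ := hLB t u hu1 hu2
    have hgap := gap_sub_le hp0 hp1 hα hβ hpα hpβ hf.eq (C := M + η) hT0
      (fun s hs => (hT s ((le_max_left _ _).trans hs)).le) i j (t := t)
      (by linarith [le_abs_self B])
    have hexp : Real.exp (i * α + j * β) ≤ Real.exp B := Real.exp_le_exp.2 hij
    have hlt : M + η - f t ≤ 2 * η := by linarith
    have h2 : (M + η - f t) * Real.exp (i * α + j * β) ≤ 2 * η * Real.exp B := by
      have : 0 ≤ 2 * η := by linarith
      gcongr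
    have h3 : 2 * η * Real.exp B = (M - c) / 4 := by
      rw [hη, Real.exp_neg]; field_simp; ring
    linarith
  have htL : 0 ≤ t - L := by linarith [abs_nonneg B]
  have hint : ∀ a : ℝ, 0 < a → a ≤ max α β →
      a * ((M + c) / 2) ≤ ∫ s in (t - L - a)..(t - L), f s := by
    intro a ha ham
    have := intervalIntegral.integral_mono_on (a := t - L - a) (b := t - L) (by linarith)
      (f := fun _ => (M + c) / 2) (g := f) (by simp) (hf.integrable _ _)
      fun s hs => hlow s (by linarith [hs.1]) hs.2
    rwa [intervalIntegral.integral_const, smul_eq_mul, sub_sub_cancel] at this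
  have hJ := hf.integral_window htL
  rw [hc] at hJ
  have h1 := mul_le_mul_of_nonneg_left (hint α hα (le_max_left _ _)) hp0.le
  have h2 := mul_le_mul_of_nonneg_left (hint β hβ (le_max_right _ _)) h1p.le
  have h3 : 0 < p * α + (1 - p) * β := by positivity
  -- The conserved window functional, with mean `c`, would be at least its value for the constant
  -- `(M + c) / 2 > c`.
  nlinarith

theorem IsHarmonic.tendsto (hpα : Real.exp α = p⁻¹) (hpβ : Real.exp β = (1 - p)⁻¹)
    {f : ℝ → ℝ} (hf : IsHarmonic p α β f) {c : ℝ}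
    (hc : p * (∫ s in (-α)..0, f s) + (1 - p) * (∫ s in (-β)..0, f s) =
      c * (p * α + (1 - p) * β))
    (hcov : ∀ δ > 0, ∃ L B : ℝ, 0 ≤ L ∧ ∀ t u : ℝ, t - L - max α β ≤ u → u ≤ t - L →
      (∃ i j : ℕ, i * α + j * β ≤ B ∧ f (t - (i * α + j * β)) - δ ≤ f u) ∧
      ∃ i j : ℕ, i * α + j * β ≤ B ∧ f u ≤ f (t - (i * α + j * β)) + δ) :
    Tendsto f atTop (𝓝 c) := by
  rw [Metric.tendsto_nhds]
  intro ε hε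
  have hup := hf.eventually_le hp0 hp1 hα hβ hpα hpβ hc (fun δ hδ => by
    obtain ⟨L, B, hL, h⟩ := hcov δ hδ
    exact ⟨L, B, hL, fun t u h1 h2 => (h t u h1 h2).1⟩) (half_pos hε)
  have hlo := hf.neg.eventually_le hp0 hp1 hα hβ hpα hpβ (c := -c) (by
    simp only [intervalIntegral.integral_neg]; linarith) (fun δ hδ => by
    obtain ⟨L, B, hL, h⟩ := hcov δ hδ
    refine ⟨L, B, hL, fun t u h1 h2 => ?_⟩
    obtain ⟨i, j, hij, hu⟩ := (h t u h1 h2).2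
    exact ⟨i, j, hij, by linarith⟩) (half_pos hε)
  filter_upwards [hup, hlo] with t h1 h2
  rw [Real.dist_eq, abs_lt]
  constructor <;> linarith

end Harmonic

/-! ### The mean passage time up to `o(1)`. -/

/-- The mean passage time. -/
noncomputable def meanPassage {Ω : Type*} [MeasurableSpace Ω] (P : Measure Ω) (p : ℝ)
    (ξ : ℕ → Ω → Bool) (t : ℝ) : ℝ := ∫ ω, (firstPassage p ξ t ω : ℝ) ∂P

namespace IsLetterSeq

variable {Ω : Type*} [MeasurableSpace Ω] {P : Measure Ω} [IsProbabilityMeasure P] {p : ℝ}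
  {ξ : ℕ → Ω → Bool}

theorem integrable_firstPassage (h : IsLetterSeq P p ξ) (t : ℝ) :
    Integrable (fun ω => (firstPassage p ξ t ω : ℝ)) P := by
  refine Integrable.of_bound (h.measurable_firstPassage t).aestronglyMeasurable (passageBound p t)
    (ae_of_all _ fun ω => ?_)
  simpa using firstPassage_le_passageBound h.pos h.lt_one

omit [IsProbabilityMeasure P] in
theorem meanPassage_of_neg (h : IsLetterSeq P p ξ) {t : ℝ} (ht : t < 0) :
    meanPassage P p ξ t = 0 := by
  have : ∀ ω, firstPassage p ξ t ω = 0 := fun ω => by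
    by_contra hc
    have := (lt_firstPassage_iff h.pos h.lt_one).1 (Nat.pos_of_ne_zero hc)
    rw [walk_zero] at this
    linarith
  simp [meanPassage, this]

theorem meanPassage_mono (h : IsLetterSeq P p ξ) : Monotone (meanPassage P p ξ) := by
  intro s t hst
  refine integral_mono (h.integrable_firstPassage s) (h.integrable_firstPassage t) fun ω => ?_
  have : firstPassage p ξ s ω ≤ firstPassage p ξ t ω := by
    by_contra hc
    have h1 := (lt_firstPassage_iff h.pos h.lt_one).1 (not_le.1 hc)
    exact lt_irrefl _ ((lt_firstPassage_iff h.pos h.lt_one).2 (h1.trans hst))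
  exact Nat.cast_le.2 this

/-- Conditioning is on the last letter, not the first: this gives the same recursion without
shifting the sequence. -/
theorem prob_walk_succ_le (h : IsLetterSeq P p ξ) (n : ℕ) (t : ℝ) :
    P.real {ω | walk p ξ (n + 1) ω ≤ t} = p * P.real {ω | walk p ξ n ω ≤ t - step p true}
      + (1 - p) * P.real {ω | walk p ξ n ω ≤ t - step p false} := by
  have hind : ∀ (k : ℕ) (s : ℝ), P.real {ω | walk p ξ k ω ≤ s} =
      ∫ ω, (if walk p ξ k ω ≤ s then (1 : ℝ) else 0) ∂P := fun k s => by
    rw [← integral_indicator_one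
      (measurableSet_le ((prefixDetermined_walk p).measurable h.meas) measurable_const)]
    rfl
  simp_rw [hind]
  have := h.integral_letter (n := n)
    (F := fun b ω => if walk p ξ n ω ≤ t - step p b then (1 : ℝ) else 0)
    fun b => (prefixDetermined_walk p).comp fun x => if x ≤ t - step p b then (1 : ℝ) else 0
  rw [← this]
  simp_rw [walk_succ, le_sub_iff_add_le]

theorem meanPassage_renewal (h : IsLetterSeq P p ξ) {t : ℝ} (ht : 0 ≤ t) :
    meanPassage P p ξ t = 1 + p * meanPassage P p ξ (t - step p true)
      + (1 - p) * meanPassage P p ξ (t - step p false) := by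
  set N := max (passageBound p t)
    (max (passageBound p (t - step p true)) (passageBound p (t - step p false)))
  have h1 : passageBound p t ≤ N + 1 := (le_max_left _ _).trans (Nat.le_succ _)
  have h2 : passageBound p (t - step p true) ≤ N := (le_max_left _ _).trans (le_max_right _ _)
  have h3 : passageBound p (t - step p false) ≤ N := (le_max_right _ _).trans (le_max_right _ _)
  have h0 : P.real {ω | walk p ξ 0 ω ≤ t} = 1 := by simp [ht]
  rw [meanPassage, meanPassage, meanPassage, h.integral_firstPassage h1,
    h.integral_firstPassage h2, h.integral_firstPassage h3, Finset.sum_range_succ', h0]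
  simp_rw [h.prob_walk_succ_le]
  rw [Finset.sum_add_distrib, ← Finset.mul_sum, ← Finset.mul_sum]
  ring

/-- The mean passage time compensated by its linear growth. -/
noncomputable def excess {Ω : Type*} [MeasurableSpace Ω] (P : Measure Ω) (p : ℝ)
    (ξ : ℕ → Ω → Bool) (t : ℝ) : ℝ := meanPassage P p ξ t - t / Real.binEntropy p

omit [IsProbabilityMeasure P] in
theorem excess_of_neg (h : IsLetterSeq P p ξ) {t : ℝ} (ht : t < 0) :
    excess P p ξ t = -t / Real.binEntropy p := by
  rw [excess, h.meanPassage_of_neg ht]; ring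

theorem excess_renewal (h : IsLetterSeq P p ξ) {t : ℝ} (ht : 0 ≤ t) :
    excess P p ξ t = p * excess P p ξ (t - step p true)
      + (1 - p) * excess P p ξ (t - step p false) := by
  have hH := entropy_pos h.pos h.lt_one
  simp only [excess]
  rw [h.meanPassage_renewal ht]
  field_simp
  rw [binEntropy_eq_step]
  ring

theorem excess_mem_Icc (h : IsLetterSeq P p ξ) {t : ℝ} (ht : -maxStep p ≤ t) :
    excess P p ξ t ∈ Set.Icc 0 (maxStep p / Real.binEntropy p) := by
  have hH := entropy_pos h.pos h.lt_one
  have hm := minStep_pos h.pos h.lt_one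
  -- A maximum principle: on `[-maxStep, 0)` the bounds are explicit, and each further stretch of
  -- length `minStep` averages values already bounded.
  suffices key : ∀ (n : ℕ) (t : ℝ), -maxStep p ≤ t → t < n * minStep p →
      excess P p ξ t ∈ Set.Icc 0 (maxStep p / Real.binEntropy p) by
    obtain ⟨n, hn⟩ := exists_nat_gt (t / minStep p)
    exact key n t ht ((div_lt_iff₀ hm).1 hn)
  intro n
  induction n with
  | zero =>
    intro t ht1 ht2
    have ht0 : t < 0 := by simpa using ht2
    rw [h.excess_of_neg ht0]
    exact ⟨div_nonneg (by linarith) hH.le, div_le_div_of_nonneg_right (by linarith) hH.le⟩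
  | succ n ih =>
    intro t ht1 ht2
    rcases lt_or_ge t 0 with ht0 | ht0
    · rw [h.excess_of_neg ht0]
      exact ⟨div_nonneg (by linarith) hH.le, div_le_div_of_nonneg_right (by linarith) hH.le⟩
    push_cast at ht2
    have hb : ∀ b, excess P p ξ (t - step p b) ∈ Set.Icc 0 (maxStep p / Real.binEntropy p) :=
      fun b => ih _ (by linarith [step_le_maxStep p b]) (by linarith [minStep_le_step p b])
    rw [h.excess_renewal ht0]
    have hp := h.pos
    have hp1 : 0 < 1 - p := by linarith [h.lt_one]
    obtain ⟨a1, a2⟩ := hb true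
    obtain ⟨b1, b2⟩ := hb false
    exact ⟨by positivity, by nlinarith⟩

theorem isHarmonic_excess (h : IsLetterSeq P p ξ) :
    IsHarmonic p (step p true) (step p false) (excess P p ξ) where
  eq _ ht := h.excess_renewal ht
  bdd := ⟨maxStep p / Real.binEntropy p, fun t ht => by
    have := h.excess_mem_Icc (t := t) (by linarith [maxStep_pos h.pos h.lt_one])
    rw [abs_of_nonneg this.1]
    exact this.2⟩
  integrable a b := h.meanPassage_mono.intervalIntegrable.sub
    ((continuous_id.div_const (Real.binEntropy p)).intervalIntegrable a b)

omit [IsProbabilityMeasure P] in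
theorem integral_excess_neg (h : IsLetterSeq P p ξ) {a : ℝ} (ha : 0 < a) :
    ∫ s in (-a)..0, excess P p ξ s = a ^ 2 / (2 * Real.binEntropy p) := by
  have hH := entropy_pos h.pos h.lt_one
  have : ∫ s in (-a)..0, excess P p ξ s = ∫ s in (-a)..0, -s / Real.binEntropy p := by
    refine intervalIntegral.integral_congr_ae ?_
    have h0 : ∀ᵐ s : ℝ, s ≠ 0 := by simp [ae_iff]
    filter_upwards [h0] with s hs0 hs
    rw [Set.uIoc_of_le (by linarith)] at hs
    exact h.excess_of_neg (lt_of_le_of_ne hs.2 hs0)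
  rw [this, intervalIntegral.integral_div, intervalIntegral.integral_neg, integral_id]
  field_simp
  ring

/-- The renewal theorem, for steps with incommensurable values. -/
theorem tendsto_excess_of_irrational (h : IsLetterSeq P p ξ)
    (hirr : Irrational (Real.log p / Real.log (1 - p))) :
    Tendsto (excess P p ξ) atTop (𝓝 (secondMoment p / (2 * Real.binEntropy p ^ 2))) := by
  have hH := entropy_pos h.pos h.lt_one
  have hα := step_pos h.pos h.lt_one true
  have hβ := step_pos h.pos h.lt_one false
  refine h.isHarmonic_excess.tendsto h.pos h.lt_one hα hβ (exp_step_true h.pos)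
    (exp_step_false h.lt_one) ?_ ?_
  -- Since `f s = -s / H` for `s < 0`, the window functional equals `(p α² + q β²) / (2H) = H₂ /
  -- (2H)`.
  · rw [h.integral_excess_neg hα, h.integral_excess_neg hβ, ← binEntropy_eq_step,
      secondMoment_eq_step]
    field_simp
  intro δ hδ
  have hdense : Dense (AddSubgroup.closure {step p true, step p false} : Set ℝ) := by
    rw [dense_addSubgroupClosure_pair_iff, step_true, step_false, neg_div_neg_eq]
    exact hirr
  obtain ⟨e, he, he0, heδ⟩ := hdense.exists_between (show (0 : ℝ) < δ * Real.binEntropy p by positivity)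
  obtain ⟨m, n, hmn⟩ := AddSubgroup.mem_closure_pair.1 he
  obtain ⟨L, hL⟩ := exists_natComb_mem_Ioc (α := step p true) (m := m) (n := n) hβ he0
    (by simpa using hmn.symm)
  refine ⟨max L 0, max L 0 + max (step p true) (step p false) + e, le_max_right _ _,
    fun t u hu1 hu2 => ?_⟩
  have hLm : L ≤ max L 0 := le_max_left _ _
  -- As `E ν` is monotone, the excess can fall by at most `e / H < δ` over a length `e`. A translate
  -- within `e` to the left of `u`, and one to the right, thus give the two one-sided comparisons.
  have hslope : ∀ x y : ℝ, x ≤ y → y ≤ x + e → excess P p ξ x ≤ excess P p ξ y + δ := by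
    intro x y hxy hye
    have hmono := h.meanPassage_mono hxy
    have : (y - x) / Real.binEntropy p ≤ δ := (div_le_iff₀ hH).2 (by linarith)
    rw [sub_div] at this
    simp only [excess]
    linarith
  obtain ⟨i, j, hij⟩ := hL (t - u + e) (by linarith)
  obtain ⟨i', j', hij'⟩ := hL (t - u) (by linarith)
  refine ⟨⟨i, j, by linarith [hij.2], ?_⟩, ⟨i', j', by linarith [hij'.2], ?_⟩⟩
  · linarith [hslope (t - (i * step p true + j * step p false)) u (by linarith [hij.1])
      (by linarith [hij.2])]
  · exact hslope u _ (by linarith [hij'.2]) (by linarith [hij'.1])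

end IsLetterSeq

/-- The generator of the group of values of an arithmetic walk. -/
theorem IsSpan.exists_coeffs {p d : ℝ} (hp0 : 0 < p) (hp1 : p < 1) (hd : IsSpan p d) :
    0 < d ∧ ∃ a b m n : ℤ, step p true = a * d ∧ step p false = b * d ∧ m * a + n * b = 1 := by
  obtain ⟨⟨hd0, ⟨a, ha⟩, ⟨b, hb⟩⟩, hmax⟩ := hd
  have hgpos : 0 < Int.gcd a b := by
    refine Int.gcd_pos_of_ne_zero_left _ ?_
    rintro rfl
    have := step_pos hp0 hp1 true
    rw [step_true, ha] at this
    simp at this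
  have hg : Int.gcd a b = 1 := by
    obtain ⟨a', ha'⟩ := Int.gcd_dvd_left (a := a) (b := b)
    obtain ⟨b', hb'⟩ := Int.gcd_dvd_right (a := a) (b := b)
    have hgR : (0 : ℝ) < (Int.gcd a b : ℝ) := by exact_mod_cast hgpos
    have haR : (a : ℝ) = (Int.gcd a b : ℝ) * a' := by exact_mod_cast congrArg (Int.cast (R := ℝ)) ha'
    have hbR : (b : ℝ) = (Int.gcd a b : ℝ) * b' := by exact_mod_cast congrArg (Int.cast (R := ℝ)) hb'
    have hle : (Int.gcd a b : ℝ) * d ≤ d := hmax ⟨by positivity, ⟨a', by rw [ha, haR]; ring⟩,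
      ⟨b', by rw [hb, hbR]; ring⟩⟩
    have h1 : (Int.gcd a b : ℝ) ≤ 1 := by
      by_contra hc
      nlinarith
    have h2 : Int.gcd a b ≤ 1 := by exact_mod_cast h1
    omega
  obtain ⟨m, n, hmn⟩ := Int.isCoprime_iff_gcd_eq_one.2 hg
  exact ⟨hd0, a, b, m, n, by rw [step_true, ha], by rw [step_false, hb], hmn⟩

theorem intervalIntegrable_fract_div (d a b : ℝ) (hd : 0 < d) :
    IntervalIntegrable (fun s => Int.fract (s / d)) volume a b := by
  have hmono : Monotone fun s : ℝ => ((⌊s / d⌋ : ℤ) : ℝ) := fun x y hxy =>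
    Int.cast_le.2 (Int.floor_mono (div_le_div_of_nonneg_right hxy hd.le))
  exact ((continuous_id.div_const d).intervalIntegrable a b).sub hmono.intervalIntegrable

theorem integral_fract_div {d : ℝ} (hd : 0 < d) (a : ℤ) :
    ∫ s in (-(a * d))..0, Int.fract (s / d) = a * d / 2 := by
  have hper : Function.Periodic (fun s : ℝ => Int.fract (s / d)) d := fun s => by
    simp only [add_div, div_self hd.ne', Int.fract_add_one]
  have h1 := hper.intervalIntegral_add_zsmul_eq a (-(a * d))
    fun _ _ => intervalIntegrable_fract_div d _ _ hd
  have h2 := hper.intervalIntegral_add_eq (-(a * d)) 0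
  have h3 : ∫ s in (0:ℝ)..(0 + d), Int.fract (s / d) = ∫ s in (0:ℝ)..(0 + d), s / d := by
    refine intervalIntegral.integral_congr_ae ?_
    have h0 : ∀ᵐ s : ℝ, s ≠ d := by simp [ae_iff]
    filter_upwards [h0] with s hs0 hs
    rw [zero_add, Set.uIoc_of_le hd.le] at hs
    refine Int.fract_eq_self.2 ⟨div_nonneg hs.1.le hd.le, ?_⟩
    rw [div_lt_one hd]
    exact lt_of_le_of_ne hs.2 hs0
  rw [h2, h3, intervalIntegral.integral_div, integral_id] at h1
  simp only [zsmul_eq_mul, neg_add_cancel] at h1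
  rw [h1]
  field_simp
  ring

namespace IsLetterSeq

variable {Ω : Type*} [MeasurableSpace Ω] {P : Measure Ω} [IsProbabilityMeasure P] {p : ℝ}
  {ξ : ℕ → Ω → Bool}

/-- The renewal theorem, for arithmetic steps. -/
theorem tendsto_excess_of_isSpan (h : IsLetterSeq P p ξ) {d : ℝ} (hd : IsSpan p d) :
    Tendsto (fun t => excess P p ξ t - oscillation p d t) atTop
      (𝓝 (secondMoment p / (2 * Real.binEntropy p ^ 2))) := by
  have hH := entropy_pos h.pos h.lt_one
  have hα := step_pos h.pos h.lt_one true
  have hβ := step_pos h.pos h.lt_one false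
  obtain ⟨hd0, a, b, m, n, ha, hb, hmn⟩ := hd.exists_coeffs h.pos h.lt_one
  have hfr : ∀ (t : ℝ) (k : ℤ), Int.fract ((t - k * d) / d) = Int.fract (t / d) := fun t k => by
    rw [sub_div, mul_div_assoc, div_self hd0.ne', mul_one, Int.fract_sub_intCast]
  set f : ℝ → ℝ := fun t => excess P p ξ t + d / Real.binEntropy p * Int.fract (t / d) with hf
  have hharm : IsHarmonic p (step p true) (step p false) f := by
    refine ⟨fun t ht => ?_, ?_, fun x y => ?_⟩
    · simp only [hf]
      rw [h.excess_renewal ht, ha, hb, hfr, hfr]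
      ring
    · obtain ⟨B, hB⟩ := h.isHarmonic_excess.bdd
      refine ⟨B + d / Real.binEntropy p, fun t ht => (abs_add_le _ _).trans ?_⟩
      have hdH : 0 < d / Real.binEntropy p := by positivity
      rw [abs_mul, abs_of_pos hdH, abs_of_nonneg (Int.fract_nonneg (t / d))]
      nlinarith [hB t ht, Int.fract_lt_one (t / d)]
    · exact (h.isHarmonic_excess.integrable x y).add
        ((intervalIntegrable_fract_div d x y hd0).const_mul _)
  -- The walk lives on `dℤ`, so `E ν(t)` depends on `⌊t / d⌋` only, and adding the fractional part
  -- turns `-t / H` into a function of `⌊t / d⌋` as well.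
  have hfloor : ∀ s u : ℝ, ⌊s / d⌋ = ⌊u / d⌋ → f s = f u := by
    have hval : ∀ n ω, ∃ k : ℤ, walk p ξ n ω = k * d := fun n ω => by
      induction n with
      | zero => exact ⟨0, by simp⟩
      | succ n ih =>
        obtain ⟨k, hk⟩ := ih
        rw [walk_succ, hk]
        cases ξ n ω
        · exact ⟨k + b, by rw [hb]; push_cast; ring⟩
        · exact ⟨k + a, by rw [ha]; push_cast; ring⟩
    have hmean : ∀ s u : ℝ, ⌊s / d⌋ = ⌊u / d⌋ → meanPassage P p ξ s = meanPassage P p ξ u := by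
      intro s u hsu
      have hiff : ∀ ω n, n < firstPassage p ξ s ω ↔ n < firstPassage p ξ u ω := fun ω n => by
        obtain ⟨k, hk⟩ := hval n ω
        rw [lt_firstPassage_iff h.pos h.lt_one, lt_firstPassage_iff h.pos h.lt_one, hk,
          ← le_div_iff₀ hd0, ← le_div_iff₀ hd0, ← Int.le_floor, ← Int.le_floor, hsu]
      have : ∀ ω, firstPassage p ξ s ω = firstPassage p ξ u ω := fun ω =>
        eq_of_forall_lt_iff (hiff ω)
      simp only [meanPassage, this]
    have hfeq : ∀ s, f s = meanPassage P p ξ s - d / Real.binEntropy p * ⌊s / d⌋ := fun s => by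
      simp only [hf, excess, Int.fract]
      field_simp
      ring
    intro s u hsu
    rw [hfeq, hfeq, hmean s u hsu, hsu]
  have hlim := hharm.tendsto h.pos h.lt_one hα hβ (exp_step_true h.pos) (exp_step_false h.lt_one)
    (c := secondMoment p / (2 * Real.binEntropy p ^ 2) + d / Real.binEntropy p / 2) ?_ ?_
  · have := hlim.sub_const (d / Real.binEntropy p / 2)
    rw [add_sub_cancel_right] at this
    refine this.congr fun t => ?_
    simp only [hf, oscillation]
    ring
  · have hi : ∀ c : ℤ, 0 < (c : ℝ) * d → ∫ s in (-(c * d))..0, f s =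
        (c * d) ^ 2 / (2 * Real.binEntropy p) + d / Real.binEntropy p * (c * d / 2) := fun c hc => by
      rw [← h.integral_excess_neg hc, ← integral_fract_div hd0,
        ← intervalIntegral.integral_const_mul, ← intervalIntegral.integral_add
          (h.isHarmonic_excess.integrable _ _) ((intervalIntegrable_fract_div d _ _ hd0).const_mul _)]
    have hHeq := binEntropy_eq_step p
    rw [ha, hb] at hHeq
    rw [secondMoment_eq_step, ha, hb, hi a (ha ▸ hα), hi b (hb ▸ hβ), ← hHeq]
    generalize Real.binEntropy p = H at *
    field_simp
    rw [hHeq]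
    ring
  · intro δ hδ
    obtain ⟨L, hL⟩ := exists_natComb_mem_Ioc (α := step p true) (m := m) (n := n) hβ hd0 (by
      rw [ha, hb]
      have : (m * a + n * b : ℝ) = 1 := by exact_mod_cast congrArg (Int.cast (R := ℝ)) hmn
      linear_combination -d * this)
    refine ⟨max (L + d) 0, max (L + d) 0 + max (step p true) (step p false) + d, le_max_right _ _,
      fun t u hu1 hu2 => ?_⟩
    have hLm : L + d ≤ max (L + d) 0 := le_max_left _ _
    have t1 : ⌊t / d⌋ * d ≤ t := by rw [← le_div_iff₀ hd0]; exact Int.floor_le _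
    have t2 : t < (⌊t / d⌋ + 1) * d := by rw [← div_lt_iff₀ hd0]; exact Int.lt_floor_add_one _
    have u1 : ⌊u / d⌋ * d ≤ u := by rw [← le_div_iff₀ hd0]; exact Int.floor_le _
    have u2 : u < (⌊u / d⌋ + 1) * d := by rw [← div_lt_iff₀ hd0]; exact Int.lt_floor_add_one _
    -- The half-open interval of length `d` contains exactly one lattice point, so the translate
    -- lands in the very cell of `u`. Passing to cells may lose up to `d`, whence `L + d`.
    obtain ⟨i, j, hij⟩ := hL ((⌊t / d⌋ - ⌊u / d⌋) * d) (by linarith)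
    have hEq : i * a + j * b = ⌊t / d⌋ - ⌊u / d⌋ := by
      have e1 : (i * step p true + j * step p false) = ((i * a + j * b : ℤ) : ℝ) * d := by
        rw [ha, hb]; push_cast; ring
      rw [e1] at hij
      have l1 : ((⌊t / d⌋ - ⌊u / d⌋ - 1 : ℤ) : ℝ) < ((i * a + j * b : ℤ) : ℝ) := by
        refine lt_of_mul_lt_mul_right ?_ hd0.le
        have := hij.1
        push_cast at this ⊢
        linarith
      have l2 : ((i * a + j * b : ℤ) : ℝ) ≤ ((⌊t / d⌋ - ⌊u / d⌋ : ℤ) : ℝ) := by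
        refine le_of_mul_le_mul_right ?_ hd0
        have := hij.2
        push_cast at this ⊢
        linarith
      have l1' : ⌊t / d⌋ - ⌊u / d⌋ - 1 < i * a + j * b := by exact_mod_cast l1
      have l2' : i * a + j * b ≤ ⌊t / d⌋ - ⌊u / d⌋ := by exact_mod_cast l2
      omega
    have hs : f (t - (i * step p true + j * step p false)) = f u := by
      refine hfloor _ _ ?_
      have e1 : (i * step p true + j * step p false) = ((i * a + j * b : ℤ) : ℝ) * d := by
        rw [ha, hb]; push_cast; ring
      rw [e1, hEq, sub_div, mul_div_assoc, div_self hd0.ne', mul_one, Int.floor_sub_intCast]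
      ring
    have hle : i * step p true + j * step p false ≤
        max (L + d) 0 + max (step p true) (step p false) + d := by linarith [hij.2]
    exact ⟨⟨i, j, hle, by linarith⟩, ⟨i, j, hle, by linarith⟩⟩

end IsLetterSeq

/-! ### Weak convergence with second moments, and truncation. -/

/-- Convergence in distribution together with convergence of the second moments. -/
structure TendstoSq {Ω Ω' ι : Type*} [MeasurableSpace Ω] [MeasurableSpace Ω'] (W : ι → Ω → ℝ)
    (l : Filter ι) (Z : Ω' → ℝ) (P : Measure Ω) (P' : Measure Ω') [IsProbabilityMeasure P]
    [IsProbabilityMeasure P'] : Prop where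
  dist : TendstoInDistribution W l Z (fun _ => P) P'
  memLp : ∀ i, MemLp (W i) 2 P
  memLp_limit : MemLp Z 2 P'
  sq : Tendsto (fun i => ∫ ω, W i ω ^ 2 ∂P) l (𝓝 (∫ ω, Z ω ^ 2 ∂P'))

section WeakConvergence

variable {Ω Ω' ι κ : Type*} [MeasurableSpace Ω] [MeasurableSpace Ω'] {W : ι → Ω → ℝ}
  {l : Filter ι} {Z : Ω' → ℝ} {P : Measure Ω} {P' : Measure Ω'} [IsProbabilityMeasure P]
  [IsProbabilityMeasure P']

theorem tendsto_integral_comp_of_bounded (h : TendstoInDistribution W l Z (fun _ => P) P')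
    {f : ℝ → ℝ} (hf : Continuous f) {C : ℝ} (hC : ∀ x, |f x| ≤ C) :
    Tendsto (fun i => ∫ ω, f (W i ω) ∂P) l (𝓝 (∫ ω, f (Z ω) ∂P')) := by
  have h1 := (ProbabilityMeasure.tendsto_iff_forall_integral_tendsto.1 h.tendsto)
    (BoundedContinuousFunction.ofNormedAddCommGroup f hf C hC)
  simp only [ProbabilityMeasure.coe_mk, BoundedContinuousFunction.coe_ofNormedAddCommGroup] at h1
  rw [integral_map h.aemeasurable_limit hf.aestronglyMeasurable] at h1
  refine h1.congr fun i => ?_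
  rw [integral_map (h.forall_aemeasurable i) hf.aestronglyMeasurable]

/-- Lower semicontinuity of the integral of a nonnegative continuous function. -/
theorem eventually_lt_integral_comp (h : TendstoInDistribution W l Z (fun _ => P) P')
    {f : ℝ → ℝ} (hf : Continuous f) (h0 : ∀ x, 0 ≤ f x)
    (hW : ∀ i, Integrable (fun ω => f (W i ω)) P) (hZ : Integrable (fun ω => f (Z ω)) P')
    {c : ℝ} (hc : c < ∫ ω, f (Z ω) ∂P') : ∀ᶠ i in l, c < ∫ ω, f (W i ω) ∂P := by
  have hlim : Tendsto (fun A : ℕ => ∫ ω, min (f (Z ω)) A ∂P') atTop (𝓝 (∫ ω, f (Z ω) ∂P')) := by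
    refine tendsto_integral_of_dominated_convergence (fun ω => f (Z ω)) (fun A => ?_) hZ
      (fun A => ae_of_all _ fun ω => ?_) (ae_of_all _ fun ω => ?_)
    · exact hZ.aestronglyMeasurable.inf aestronglyMeasurable_const
    · rw [Real.norm_of_nonneg (le_min (h0 _) (Nat.cast_nonneg _))]
      exact min_le_left _ _
    · refine tendsto_const_nhds.congr' ?_
      obtain ⟨N, hN⟩ := exists_nat_ge (f (Z ω))
      filter_upwards [eventually_ge_atTop N] with A hA
      exact (min_eq_left (hN.trans (Nat.cast_le.2 hA))).symm
  obtain ⟨A, hA⟩ := (hlim.eventually_const_lt hc).exists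
  have hb := tendsto_integral_comp_of_bounded h (f := fun x => min (f x) A)
    (hf.min continuous_const) (C := A) fun x => by
      rw [abs_of_nonneg (le_min (h0 _) (Nat.cast_nonneg _))]
      exact min_le_right _ _
  filter_upwards [hb.eventually_const_lt hA] with i hi
  refine hi.trans_le (integral_mono_of_nonneg (ae_of_all _ fun ω => ?_) (hW i)
    (ae_of_all _ fun ω => min_le_left _ _))
  exact le_min (h0 _) (Nat.cast_nonneg _)

/-- Convergence in distribution is insensitive to errors vanishing in quadratic mean. -/
theorem tendstoInDistribution_add_error (h : TendstoInDistribution W l Z (fun _ => P) P')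
    {e : ι → Ω → ℝ} (he : ∀ i, MemLp (e i) 2 P)
    (he0 : Tendsto (fun i => ∫ ω, e i ω ^ 2 ∂P) l (𝓝 0)) :
    TendstoInDistribution (fun i ω => W i ω + e i ω) l Z (fun _ => P) P' := by
  have hm : ∀ i, AEMeasurable (fun ω => W i ω + e i ω) P := fun i =>
    (h.forall_aemeasurable i).add (he i).aestronglyMeasurable.aemeasurable
  set law : ι → ProbabilityMeasure ℝ := fun i =>
    ⟨P.map (W i), Measure.isProbabilityMeasure_map (h.forall_aemeasurable i)⟩
  set μ : ProbabilityMeasure ℝ :=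
    ⟨P'.map Z, Measure.isProbabilityMeasure_map h.aemeasurable_limit⟩
  -- Lipschitz test functions need a countably generated filter, so `l` is enlarged to one.
  set l' : Filter ι := comap law (𝓝 μ) ⊓ comap (fun i => ∫ ω, e i ω ^ 2 ∂P) (𝓝 0)
  have hl : l ≤ l' := le_inf (tendsto_iff_comap.1 h.tendsto) (tendsto_iff_comap.1 he0)
  have h' : TendstoInDistribution W l' Z (fun _ => P) P' :=
    ⟨h.forall_aemeasurable, h.aemeasurable_limit, tendsto_comap.mono_left inf_le_left⟩
  have he' : Tendsto (fun i => ∫ ω, e i ω ^ 2 ∂P) l' (𝓝 0) := tendsto_comap.mono_left inf_le_right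
  have key := tendstoInDistribution_of_tendstoInMeasure_sub (fun i ω => W i ω + e i ω) Z h' ?_ hm
  · exact ⟨hm, h.aemeasurable_limit, key.tendsto.mono_left hl⟩
  · rw [tendstoInMeasure_iff_measureReal_norm]
    intro ε hε
    have hlim := he'.div_const (ε ^ 2)
    rw [zero_div] at hlim
    refine squeeze_zero (fun i => measureReal_nonneg) (fun i => ?_) hlim
    rw [le_div_iff₀ (by positivity), mul_comm]
    have hset : {ω | ε ≤ ‖((fun i ω => W i ω + e i ω) - W) i ω - (0 : Ω → ℝ) ω‖} =
        {ω | ε ^ 2 ≤ e i ω ^ 2} := by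
      ext ω
      simp [abs_of_pos hε, sq_le_sq]
    rw [hset]
    exact mul_meas_ge_le_integral_of_nonneg (ae_of_all _ fun ω => sq_nonneg _)
      (he i).integrable_sq _

namespace TendstoSq

theorem comp_tendsto (h : TendstoSq W l Z P P') {l' : Filter κ} {φ : κ → ι} (hφ : Tendsto φ l' l) :
    TendstoSq (fun k => W (φ k)) l' Z P P' where
  dist := ⟨fun _ => h.dist.forall_aemeasurable _, h.dist.aemeasurable_limit,
    h.dist.tendsto.comp hφ⟩
  memLp _ := h.memLp _
  memLp_limit := h.memLp_limit
  sq := h.sq.comp hφ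

theorem integrable_of_le {Y : Ω → ℝ} (hY : MemLp Y 2 P) {f : ℝ → ℝ} (hf : Continuous f) {C : ℝ}
    (hC : ∀ x, |f x| ≤ C * (1 + x ^ 2)) : Integrable (fun ω => f (Y ω)) P :=
  (((integrable_const 1).add hY.integrable_sq).const_mul C).mono'
    (hf.comp_aestronglyMeasurable hY.aestronglyMeasurable) (ae_of_all _ fun ω => hC (Y ω))

theorem integral_quadratic_add {Y : Ω → ℝ} (hY : MemLp Y 2 P) {f : ℝ → ℝ} (hf : Continuous f)
    {C : ℝ} (hC : ∀ x, |f x| ≤ C * (1 + x ^ 2)) :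
    ∫ ω, (C * (1 + Y ω ^ 2) + f (Y ω)) ∂P = C * (1 + ∫ ω, Y ω ^ 2 ∂P) + ∫ ω, f (Y ω) ∂P := by
  have h1 : Integrable (fun ω => 1 + Y ω ^ 2) P := (integrable_const 1).add hY.integrable_sq
  rw [integral_add (h1.const_mul C) (integrable_of_le hY hf hC), integral_const_mul,
    integral_add (integrable_const _) hY.integrable_sq]
  simp

/-- Test functions of quadratic growth are admissible. -/
theorem integral_comp (h : TendstoSq W l Z P P') {f : ℝ → ℝ} (hf : Continuous f) {C : ℝ}
    (hC : ∀ x, |f x| ≤ C * (1 + x ^ 2)) :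
    Tendsto (fun i => ∫ ω, f (W i ω) ∂P) l (𝓝 (∫ ω, f (Z ω) ∂P')) := by
  -- Lower semicontinuity applies to `C (1 + x²) + g ≥ 0`, and the integrals of the quadratic part
  -- converge, so they can be subtracted. Taking `g = f` and `g = -f` gives both bounds.
  have hlow : ∀ g : ℝ → ℝ, Continuous g → (∀ x, |g x| ≤ C * (1 + x ^ 2)) → ∀ ε > 0,
      ∀ᶠ i in l, ∫ ω, g (Z ω) ∂P' - ε < ∫ ω, g (W i ω) ∂P := by
    intro g hg hgC ε hε
    have hcont : Continuous fun x => C * (1 + x ^ 2) + g x := by fun_prop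
    have h1 := eventually_lt_integral_comp h.dist (f := fun x => C * (1 + x ^ 2) + g x)
      hcont (fun x => by linarith [(abs_le.1 (hgC x)).1])
      (fun i => (((integrable_const 1).add (h.memLp i).integrable_sq).const_mul C).add
        (integrable_of_le (h.memLp i) hg hgC))
      ((((integrable_const 1).add h.memLp_limit.integrable_sq).const_mul C).add
        (integrable_of_le h.memLp_limit hg hgC))
      (c := C * (1 + ∫ ω, Z ω ^ 2 ∂P') + ∫ ω, g (Z ω) ∂P' - ε / 2)
      (by rw [integral_quadratic_add h.memLp_limit hg hgC]; linarith)
    have h2 := ((h.sq.const_add 1).const_mul C).eventually_lt_const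
      (show C * (1 + ∫ ω, Z ω ^ 2 ∂P') < C * (1 + ∫ ω, Z ω ^ 2 ∂P') + ε / 2 by linarith)
    filter_upwards [h1, h2] with i h1 h2
    rw [integral_quadratic_add (h.memLp i) hg hgC] at h1
    linarith
  rw [Metric.tendsto_nhds]
  intro ε hε
  have hneg := hlow (fun x => -f x) hf.neg (by simpa using hC) ε hε
  simp only [integral_neg] at hneg
  filter_upwards [hlow f hf hC ε hε, hneg] with i h1 h2
  rw [Real.dist_eq, abs_lt]
  constructor <;> linarith

theorem integral (h : TendstoSq W l Z P P') :
    Tendsto (fun i => ∫ ω, W i ω ∂P) l (𝓝 (∫ ω, Z ω ∂P')) :=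
  h.integral_comp continuous_id (C := 1) fun x => by
    rw [id, abs_le]
    constructor <;> nlinarith [sq_nonneg (x + 1), sq_nonneg (x - 1)]

theorem variance (h : TendstoSq W l Z P P') :
    Tendsto (fun i => Var[W i; P]) l (𝓝 Var[Z; P']) := by
  rw [variance_eq_sub h.memLp_limit]
  simp_rw [fun i => variance_eq_sub (h.memLp i)]
  exact h.sq.sub (h.integral.pow 2)

theorem comp_continuous (h : TendstoSq W l Z P P') {f : ℝ → ℝ} (hf : Continuous f) {C : ℝ}
    (hC : ∀ x, f x ^ 2 ≤ C * (1 + x ^ 2)) :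
    TendstoSq (fun i ω => f (W i ω)) l (fun ω => f (Z ω)) P P' where
  dist := h.dist.continuous_comp hf
  memLp i := (memLp_two_iff_integrable_sq
    (hf.comp_aestronglyMeasurable (h.memLp i).aestronglyMeasurable)).2
      (integrable_of_le (h.memLp i) (hf.pow 2) fun x => by rw [abs_of_nonneg (sq_nonneg _)]; exact hC x)
  memLp_limit := (memLp_two_iff_integrable_sq
    (hf.comp_aestronglyMeasurable h.memLp_limit.aestronglyMeasurable)).2
      (integrable_of_le h.memLp_limit (hf.pow 2) fun x => by
        rw [abs_of_nonneg (sq_nonneg _)]; exact hC x)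
  sq := h.integral_comp (hf.pow 2) fun x => by rw [abs_of_nonneg (sq_nonneg _)]; exact hC x

theorem add_error (h : TendstoSq W l Z P P') {e : ι → Ω → ℝ} (he : ∀ i, MemLp (e i) 2 P)
    (he0 : Tendsto (fun i => ∫ ω, e i ω ^ 2 ∂P) l (𝓝 0)) :
    TendstoSq (fun i ω => W i ω + e i ω) l Z P P' where
  dist := tendstoInDistribution_add_error h.dist he he0
  memLp i := (h.memLp i).add (he i)
  memLp_limit := h.memLp_limit
  sq := by
    have hdiff : Tendsto (fun i => ∫ ω, (W i ω + e i ω) ^ 2 ∂P - ∫ ω, W i ω ^ 2 ∂P) l (𝓝 0) := by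
      rw [Metric.tendsto_nhds]
      intro ε hε
      set B := ∫ ω, Z ω ^ 2 ∂P' + 1
      have hB : 0 < B := by
        have : 0 ≤ ∫ ω, Z ω ^ 2 ∂P' := integral_nonneg fun ω => sq_nonneg _
        positivity
      set δ := ε / (2 * B)
      have hδ : 0 < δ := by positivity
      have h1 := h.sq.eventually_lt_const (show _ < B from lt_add_one _)
      have h2 := (he0.const_mul (1 + δ⁻¹)).eventually_lt_const
        (show (1 + δ⁻¹) * 0 < ε / 2 by rw [mul_zero]; positivity)
      filter_upwards [h1, h2] with i h1 h2
      have hWi := (h.memLp i).integrable_sq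
      have hei := (he i).integrable_sq
      have hsum : Integrable (fun ω => (W i ω + e i ω) ^ 2) P :=
        ((h.memLp i).add (he i)).integrable_sq
      rw [Real.dist_eq, sub_zero, ← integral_sub hsum hWi]
      have hle : |∫ ω, ((W i ω + e i ω) ^ 2 - W i ω ^ 2) ∂P| ≤
          ∫ ω, (δ * W i ω ^ 2 + (1 + δ⁻¹) * e i ω ^ 2) ∂P := by
        refine (abs_integral_le_integral_abs).trans (integral_mono_of_nonneg
          (ae_of_all _ fun ω => abs_nonneg _) ((hWi.const_mul _).add (hei.const_mul _))
          (ae_of_all _ fun ω => ?_))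
        -- Young's inequality: a small multiple of the bounded second moment, plus a large multiple
        -- of the vanishing error.
        have e1 : ∀ x y : ℝ, |(x + y) ^ 2 - x ^ 2| ≤ δ * x ^ 2 + (1 + δ⁻¹) * y ^ 2 := by
          intro x y
          have s1 : 0 ≤ δ * (x - δ⁻¹ * y) ^ 2 := by positivity
          have s2 : 0 ≤ δ * (x + δ⁻¹ * y) ^ 2 := by positivity
          have s3 : δ * (x - δ⁻¹ * y) ^ 2 = δ * x ^ 2 - 2 * x * y + δ⁻¹ * y ^ 2 := by
            field_simp
            ring
          have s4 : δ * (x + δ⁻¹ * y) ^ 2 = δ * x ^ 2 + 2 * x * y + δ⁻¹ * y ^ 2 := by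
            field_simp
            ring
          rw [s3] at s1
          rw [s4] at s2
          rw [abs_le]
          constructor <;> nlinarith [sq_nonneg y]
        exact e1 _ _
      rw [integral_add (hWi.const_mul _) (hei.const_mul _), integral_const_mul,
        integral_const_mul] at hle
      have h3 : δ * ∫ ω, W i ω ^ 2 ∂P ≤ δ * B := by gcongr
      have h4 : δ * B = ε / 2 := by simp only [δ]; field_simp
      linarith
    simpa using hdiff.add h.sq

/-- Uniform integrability of the squares. -/
theorem tendsto_integral_tail (h : TendstoSq W l Z P P') {r : ι → ℝ}
    (hr : Tendsto (fun i => |r i|) l atTop) :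
    Tendsto (fun i => ∫ ω, max (W i ω ^ 2 - r i ^ 2) 0 ∂P) l (𝓝 0) := by
  have hlim : Tendsto (fun A : ℕ => ∫ ω, max (Z ω ^ 2 - (A : ℝ) ^ 2) 0 ∂P') atTop (𝓝 0) := by
    have h0 : ∫ _, (0 : ℝ) ∂P' = 0 := integral_zero _ _
    suffices hs : Tendsto (fun A : ℕ => ∫ ω, max (Z ω ^ 2 - (A : ℝ) ^ 2) 0 ∂P') atTop
        (𝓝 (∫ _, (0 : ℝ) ∂P')) by rwa [h0] at hs
    refine tendsto_integral_of_dominated_convergence (fun ω => Z ω ^ 2) (fun A => ?_)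
      h.memLp_limit.integrable_sq (fun A => ae_of_all _ fun ω => ?_) (ae_of_all _ fun ω => ?_)
    · exact (h.memLp_limit.integrable_sq.aestronglyMeasurable.sub aestronglyMeasurable_const).sup
        aestronglyMeasurable_const
    · rw [Real.norm_of_nonneg (le_max_right _ _)]
      exact max_le (by nlinarith [sq_nonneg (A : ℝ)]) (sq_nonneg _)
    · refine tendsto_const_nhds.congr' ?_
      obtain ⟨N, hN⟩ := exists_nat_ge |Z ω|
      filter_upwards [eventually_ge_atTop N] with A hA
      have hA' : |Z ω| ≤ A := hN.trans (Nat.cast_le.2 hA)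
      have := sq_le_sq' (by linarith [abs_nonneg (Z ω)]) hA'
      rw [sq_abs] at this
      exact (max_eq_right (by linarith)).symm
  refine tendsto_order.2 ⟨fun a ha => Eventually.of_forall fun i =>
    ha.trans_le (integral_nonneg fun ω => le_max_right _ _), fun a ha => ?_⟩
  obtain ⟨A, hA⟩ := (hlim.eventually_lt_const ha).exists
  have hbd : ∀ x : ℝ, |max (x ^ 2 - (A : ℝ) ^ 2) 0| ≤ 1 * (1 + x ^ 2) := fun x => by
    rw [abs_of_nonneg (le_max_right _ _)]
    exact max_le (by nlinarith [sq_nonneg (A : ℝ)]) (by positivity)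
  have hcont : Continuous fun x : ℝ => max (x ^ 2 - (A : ℝ) ^ 2) 0 := by fun_prop
  filter_upwards [(h.integral_comp hcont hbd).eventually_lt_const hA,
    hr.eventually_ge_atTop (A : ℝ)] with i hi hri
  refine lt_of_le_of_lt (integral_mono_of_nonneg (ae_of_all _ fun ω => le_max_right _ _)
    (integrable_of_le (h.memLp i) hcont hbd) (ae_of_all _ fun ω => ?_)) hi
  have : (A : ℝ) ^ 2 ≤ r i ^ 2 := by
    rw [← sq_abs (r i)]
    gcongr
  exact max_le_max (by linarith) le_rfl

theorem memLp_min (h : TendstoSq W l Z P P') (i : ι) (a : ℝ) :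
    MemLp (fun ω => min (W i ω) a) 2 P := by
  refine (((h.memLp i).norm).add (memLp_const |a|)).mono
    ((h.memLp i).aestronglyMeasurable.inf aestronglyMeasurable_const) (ae_of_all _ fun ω => ?_)
  simp only [Pi.add_apply, Real.norm_eq_abs]
  refine le_trans ?_ (le_abs_self _)
  rcases min_choice (W i ω) a with hm | hm <;> rw [hm]
  · linarith [abs_nonneg a]
  · linarith [abs_nonneg (W i ω)]

/-- Truncation at a level tending to infinity. -/
theorem min_atTop (h : TendstoSq W l Z P P') {r : ι → ℝ} (hr : Tendsto r l atTop) :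
    TendstoSq (fun i ω => min (W i ω) (r i)) l Z P P' := by
  have := h.add_error (e := fun i ω => min (W i ω) (r i) - W i ω)
    (fun i => (h.memLp_min i (r i)).sub (h.memLp i)) ?_
  · simpa using this
  · refine squeeze_zero' (Eventually.of_forall fun i => integral_nonneg fun ω => sq_nonneg _) ?_
      (h.tendsto_integral_tail (r := r) (tendsto_abs_atTop_atTop.comp hr))
    filter_upwards [hr.eventually_ge_atTop 0] with i hi
    refine integral_mono_of_nonneg (ae_of_all _ fun ω => sq_nonneg _)
      (((h.memLp i).integrable_sq.sub (integrable_const _)).sup (integrable_const _))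
      (ae_of_all _ fun ω => ?_)
    simp only
    rcases le_total (W i ω) (r i) with hle | hle
    · rw [min_eq_left hle]; simp
    · rw [min_eq_right hle]
      -- For `W ≥ r ≥ 0` one has `(W - r)² ≤ W² - r²`, which the uniform integrability controls.
      exact le_max_of_le_left (by nlinarith)

/-- Truncation at a converging level. -/
theorem min_nhds (h : TendstoSq W l Z P P') {r : ι → ℝ} {a : ℝ} (hr : Tendsto r l (𝓝 a)) :
    TendstoSq (fun i ω => min (W i ω) (r i)) l (fun ω => min (Z ω) a) P P' := by
  have hm : TendstoSq (fun i ω => min (W i ω) a) l (fun ω => min (Z ω) a) P P' :=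
    h.comp_continuous (f := fun x => min x a) (by fun_prop) (C := 1 + a ^ 2) fun x => by
      rcases min_choice x a with hm | hm <;> rw [hm] <;> nlinarith [sq_nonneg x, sq_nonneg a,
        mul_nonneg (sq_nonneg x) (sq_nonneg a)]
  have := hm.add_error (e := fun i ω => min (W i ω) (r i) - min (W i ω) a)
    (fun i => (h.memLp_min i (r i)).sub (h.memLp_min i a)) ?_
  · simpa using this
  · have hlim : Tendsto (fun i => (r i - a) ^ 2) l (𝓝 0) := by
      simpa using (hr.sub_const a).pow 2
    refine squeeze_zero (fun i => integral_nonneg fun ω => sq_nonneg _) (fun i => ?_) hlim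
    have : ∫ ω, (min (W i ω) (r i) - min (W i ω) a) ^ 2 ∂P ≤ ∫ _, (r i - a) ^ 2 ∂P := by
      refine integral_mono_of_nonneg (ae_of_all _ fun ω => sq_nonneg _) (integrable_const _)
        (ae_of_all _ fun ω => ?_)
      exact sq_le_sq.2 (by simpa using abs_min_sub_min_le_max (W i ω) (r i) (W i ω) a)
    simpa using this

/-- Truncation at a level tending to minus infinity. -/
theorem integral_sq_min_sub_atBot (h : TendstoSq W l Z P P') {r : ι → ℝ} (hr : Tendsto r l atBot) :
    Tendsto (fun i => ∫ ω, (min (W i ω) (r i) - r i) ^ 2 ∂P) l (𝓝 0) := by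
  refine squeeze_zero' (Eventually.of_forall fun i => integral_nonneg fun ω => sq_nonneg _) ?_
    (h.tendsto_integral_tail (r := r) (tendsto_abs_atBot_atTop.comp hr))
  filter_upwards [hr.eventually_le_atBot 0] with i hi
  refine integral_mono_of_nonneg (ae_of_all _ fun ω => sq_nonneg _)
    (((h.memLp i).integrable_sq.sub (integrable_const _)).sup (integrable_const _))
    (ae_of_all _ fun ω => ?_)
  simp only
  rcases le_total (W i ω) (r i) with hle | hle
  · rw [min_eq_left hle]
    exact le_max_of_le_left (by nlinarith)
  · rw [min_eq_right hle]; simp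

end TendstoSq

end WeakConvergence

/-! ### The central limit theorem for the passage time. -/

namespace IsLetterSeq

variable {Ω : Type*} [MeasurableSpace Ω] {P : Measure Ω} [IsProbabilityMeasure P] {p : ℝ}
  {ξ : ℕ → Ω → Bool}

theorem integral_step (h : IsLetterSeq P p ξ) (n : ℕ) (f : ℝ → ℝ) :
    ∫ ω, f (step p (ξ n ω)) ∂P = p * f (step p true) + (1 - p) * f (step p false) := by
  have := h.integral_letter (n := n) (F := fun b _ => f (step p b))
    fun _ => prefixDetermined_const _
  simpa using this

omit [IsProbabilityMeasure P] in
theorem measurable_step (h : IsLetterSeq P p ξ) (n : ℕ) :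
    Measurable fun ω => step p (ξ n ω) := (Measurable.of_discrete (f := step p)).comp (h.meas n)

theorem memLp_step (h : IsLetterSeq P p ξ) (n : ℕ) : MemLp (fun ω => step p (ξ n ω)) 2 P := by
  refine MemLp.of_bound (h.measurable_step n).aestronglyMeasurable (maxStep p)
    (ae_of_all _ fun ω => ?_)
  rw [Real.norm_of_nonneg (step_pos h.pos h.lt_one _).le]
  exact step_le_maxStep p _

theorem variance_step (h : IsLetterSeq P p ξ) (n : ℕ) :
    Var[fun ω => step p (ξ n ω); P] = stepVar p := by
  rw [variance_eq_sub (h.memLp_step n)]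
  have h1 := h.integral_step n (· ^ 2)
  have h2 := h.integral_step n id
  simp only [id] at h2
  simp only [Pi.pow_apply]
  rw [h1, h2, stepVar, secondMoment_eq_step, binEntropy_eq_step]

theorem identDistrib_step (h : IsLetterSeq P p ξ) (n : ℕ) :
    IdentDistrib (fun ω => step p (ξ n ω)) (fun ω => step p (ξ 0 ω)) P P := by
  have hξ : IdentDistrib (ξ n) (ξ 0) P P := by
    refine ⟨(h.meas n).aemeasurable, (h.meas 0).aemeasurable, ?_⟩
    refine Measure.ext_of_singleton fun b => ?_
    rw [Measure.map_apply (h.meas n) (measurableSet_singleton b),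
      Measure.map_apply (h.meas 0) (measurableSet_singleton b)]
    have h1 := (h.prob_eq n b).trans (h.prob_eq 0 b).symm
    rwa [measureReal_def, measureReal_def, ENNReal.toReal_eq_toReal_iff' (measure_ne_top _ _)
      (measure_ne_top _ _)] at h1
  exact hξ.comp (u := step p) Measurable.of_discrete

theorem memLp_firstPassage (h : IsLetterSeq P p ξ) (t : ℝ) :
    MemLp (fun ω => (firstPassage p ξ t ω : ℝ)) 2 P := by
  refine MemLp.of_bound (h.measurable_firstPassage t).aestronglyMeasurable (passageBound p t)
    (ae_of_all _ fun ω => ?_)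
  simpa using firstPassage_le_passageBound h.pos h.lt_one

/-- The minus sign anticipates that a large walk means an early passage: the negative factor
relating the walk to `ν` then gives exactly `σ̂ z`. -/
theorem hasLaw_neg_sqrt_mul {v : ℝ} (hv : 0 ≤ v) :
    HasLaw (fun z : ℝ => -√v * z) (gaussianReal 0 v.toNNReal) (gaussianReal 0 1) := by
  refine ⟨by fun_prop, ?_⟩
  rw [gaussianReal_map_const_mul]
  congr 1
  · simp
  · ext
    simp [Real.sq_sqrt hv, hv]

theorem integral_sq_gaussianReal : ∫ z : ℝ, z ^ 2 ∂gaussianReal 0 1 = 1 := by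
  have h1 := variance_fun_id_gaussianReal (μ := 0) (v := 1)
  rw [variance_of_integral_eq_zero (by fun_prop) integral_id_gaussianReal] at h1
  simpa using h1

/-- The central limit theorem for the walk. -/
theorem tendstoSq_centered (h : IsLetterSeq P p ξ) :
    TendstoSq (fun (n : ℕ) ω => (√n)⁻¹ * centered p ξ n ω) atTop (fun z : ℝ => -√(stepVar p) * z)
      P (gaussianReal 0 1) := by
  have hv : 0 ≤ stepVar p := by rw [← h.variance_step 0]; exact variance_nonneg _ _
  have hY : MemLp (fun z : ℝ => -√(stepVar p) * z) 2 (gaussianReal 0 1) :=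
    MemLp.const_mul (f := fun z : ℝ => z) (memLp_id_gaussianReal' 2 (by simp)) _
  refine ⟨?_, fun n => (h.memLp_centered n).const_mul _,
    hY, ?_⟩
  · have hmean : ∫ ω, step p (ξ 0 ω) ∂P = Real.binEntropy p := by
      rw [binEntropy_eq_step]; exact h.integral_step 0 id
    have hlaw := hasLaw_neg_sqrt_mul hv
    rw [← h.variance_step 0] at hlaw
    have hindep : iIndepFun (fun n ω => step p (ξ n ω)) P :=
      h.indep.comp (fun _ => step p) fun _ => Measurable.of_discrete
    have hclt := tendstoInDistribution_inv_sqrt_mul_sum_sub (X := fun n ω => step p (ξ n ω)) hlaw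
      (h.memLp_step 0) hindep h.identDistrib_step
    simp only [hmean] at hclt
    rw [h.variance_step 0] at hclt
    exact hclt
  · have h1 : ∫ z : ℝ, (-√(stepVar p) * z) ^ 2 ∂gaussianReal 0 1 = stepVar p := by
      simp_rw [mul_pow, neg_sq, Real.sq_sqrt hv]
      rw [integral_const_mul, integral_sq_gaussianReal, mul_one]
    rw [h1]
    refine tendsto_const_nhds.congr' ?_
    filter_upwards [eventually_gt_atTop 0] with n hn
    have hn' : (0 : ℝ) < n := Nat.cast_pos.2 hn
    simp_rw [mul_pow]
    rw [integral_const_mul, h.integral_sq_centered, inv_pow, Real.sq_sqrt hn'.le]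
    field_simp

/-- The mean distance between the passage time and its asymptotic mean. -/
theorem exists_integral_abs_sub_le (h : IsLetterSeq P p ξ) :
    ∃ C, 0 ≤ C ∧ ∀ t, 1 ≤ t → ∫ ω, |(firstPassage p ξ t ω : ℝ) - ⌊(Real.binEntropy p)⁻¹ * t⌋₊| ∂P
      ≤ C * √t := by
  have hH := entropy_pos h.pos h.lt_one
  have hm := minStep_pos h.pos h.lt_one
  have hM := maxStep_pos h.pos h.lt_one
  have hv : 0 ≤ stepVar p := by rw [← h.variance_step 0]; exact variance_nonneg _ _
  set H := Real.binEntropy p with hHdef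
  refine ⟨(maxStep p + H + 1 + stepVar p * (1 / minStep p + 1)) / H, by positivity,
    fun t ht => ?_⟩
  set n := ⌊H⁻¹ * t⌋₊
  have ht0 : 0 < t := by linarith
  have hs : 0 < √t := Real.sqrt_pos.2 ht0
  have hs1 : 1 ≤ √t := Real.one_le_sqrt.2 ht
  have hss : √t * √t = t := Real.mul_self_sqrt ht0.le
  have hn1 : n * H ≤ t := by
    have := Nat.floor_le (show 0 ≤ H⁻¹ * t by positivity)
    rwa [← le_div_iff₀ hH, div_eq_inv_mul]
  have hn2 : t < (n + 1) * H := by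
    have := Nat.lt_floor_add_one (H⁻¹ * t)
    rwa [← div_lt_iff₀ hH, div_eq_inv_mul]
  have hWald := h.integral_sq_centered_firstPassage_sub t 0
  simp only [centered_eq_sum p ξ 0, Finset.range_zero, Finset.sum_empty, sub_zero,
    Nat.cast_zero, Nat.abs_cast] at hWald
  have hEν : ∫ ω, (firstPassage p ξ t ω : ℝ) ∂P ≤ t / minStep p + 1 := by
    have : ∫ ω, (firstPassage p ξ t ω : ℝ) ∂P ≤ ∫ _, (t / minStep p + 1) ∂P := by
      refine integral_mono (h.integrable_firstPassage t) (integrable_const _) fun ω => ?_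
      exact (Nat.cast_le.2 (firstPassage_le_passageBound h.pos h.lt_one)).trans
        (passageBound_le h.pos h.lt_one ht0.le)
    simpa using this
  have hMint : Integrable (fun ω => centered p ξ (firstPassage p ξ t ω) ω ^ 2) P :=
    (h.memLp_centered_firstPassage t).integrable_sq
  have hpt : ∀ ω, |(firstPassage p ξ t ω : ℝ) - n| ≤
      H⁻¹ * (maxStep p + H + √t + (√t)⁻¹ * centered p ξ (firstPassage p ξ t ω) ω ^ 2) := by
    intro ω
    set M := centered p ξ (firstPassage p ξ t ω) ω with hMdef
    have e1 : H * (firstPassage p ξ t ω - n) =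
        walk p ξ (firstPassage p ξ t ω) ω - n * H - M := by
      rw [hMdef, centered, ← hHdef]; ring
    have hw1 := lt_walk_firstPassage (ξ := ξ) (ω := ω) (t := t) h.pos h.lt_one
    have hw2 := walk_firstPassage_le (ξ := ξ) (ω := ω) h.pos h.lt_one ht0.le
    -- Weighted at scale `√t`, so that `E M² = O(t)`, from Wald's identity and the deterministic
    -- bound on `ν`, contributes `O(√t)`.
    have hM2 : |M| ≤ √t + (√t)⁻¹ * M ^ 2 := by
      have : 0 ≤ (√t)⁻¹ * (√t - |M|) ^ 2 := by positivity
      have e : (√t)⁻¹ * (√t - |M|) ^ 2 = √t - 2 * |M| + (√t)⁻¹ * M ^ 2 := by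
        rw [← sq_abs M]; field_simp; ring
      linarith [abs_nonneg M]
    rw [inv_mul_eq_div, le_div_iff₀ hH, mul_comm, ← abs_of_pos hH, ← abs_mul, abs_of_pos hH, e1,
      abs_le]
    constructor <;> linarith [le_abs_self M, neg_abs_le M]
  have hint := integral_mono_of_nonneg (ae_of_all P fun ω => abs_nonneg
    ((firstPassage p ξ t ω : ℝ) - n)) (((integrable_const (maxStep p + H + √t)).add
      (hMint.const_mul (√t)⁻¹)).const_mul H⁻¹) (ae_of_all P hpt)
  refine hint.trans ?_
  rw [integral_const_mul]
  simp only [Pi.add_apply]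
  rw [integral_add (integrable_const _) (hMint.const_mul _), integral_const_mul, hWald,
    div_mul_eq_mul_div, div_eq_inv_mul]
  refine mul_le_mul_of_nonneg_left ?_ (inv_nonneg.2 hH.le)
  simp only [integral_const, probReal_univ, one_smul]
  have h1 : (√t)⁻¹ * (stepVar p * ∫ ω, (firstPassage p ξ t ω : ℝ) ∂P) ≤
      (√t)⁻¹ * (stepVar p * ((1 / minStep p + 1) * (√t * √t))) := by
    gcongr
    rw [hss]
    refine hEν.trans ?_
    rw [add_mul, one_mul, one_div_mul_eq_div]
    linarith
  have h2 : (√t)⁻¹ * (stepVar p * ((1 / minStep p + 1) * (√t * √t))) =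
      stepVar p * (1 / minStep p + 1) * √t := by field_simp
  nlinarith

/-- The passage time, centered and normalized. -/
noncomputable def normPassage {Ω : Type*} (p : ℝ) (ξ : ℕ → Ω → Bool) (t : ℝ) (ω : Ω) : ℝ :=
  (firstPassage p ξ t ω - t / Real.binEntropy p) / √t

theorem memLp_normPassage (h : IsLetterSeq P p ξ) (t : ℝ) : MemLp (normPassage p ξ t) 2 P := by
  have := ((h.memLp_firstPassage t).sub (memLp_const (t / Real.binEntropy p))).const_mul (√t)⁻¹
  refine this.ae_eq (ae_of_all _ fun ω => ?_)
  simp [normPassage, div_eq_inv_mul]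

theorem sigmaHat_eq (h : IsLetterSeq P p ξ) :
    sigmaHat p = √(stepVar p) * (√(Real.binEntropy p)⁻¹ / Real.binEntropy p) := by
  have hH := entropy_pos h.pos h.lt_one
  have hv : 0 ≤ stepVar p := by rw [← h.variance_step 0]; exact variance_nonneg _ _
  rw [sigmaHat, sigmaHatSq, ← stepVar, Real.sqrt_eq_iff_mul_self_eq (by positivity) (by positivity)]
  have h1 := Real.mul_self_sqrt hv
  have h2 := Real.mul_self_sqrt (inv_nonneg.2 hH.le)
  calc stepVar p / Real.binEntropy p ^ 3
      = stepVar p * (Real.binEntropy p)⁻¹ / Real.binEntropy p ^ 2 := by field_simp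
    _ = (√(stepVar p) * √(stepVar p)) * (√(Real.binEntropy p)⁻¹ * √(Real.binEntropy p)⁻¹)
          / Real.binEntropy p ^ 2 := by rw [h1, h2]
    _ = _ := by ring

/-- The central limit theorem for the passage time. -/
theorem tendstoSq_normPassage (h : IsLetterSeq P p ξ) :
    TendstoSq (normPassage p ξ) atTop (fun z : ℝ => sigmaHat p * z) P (gaussianReal 0 1) := by
  have hH := entropy_pos h.pos h.lt_one
  have hM := maxStep_pos h.pos h.lt_one
  have hv : 0 ≤ stepVar p := by rw [← h.variance_step 0]; exact variance_nonneg _ _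
  obtain ⟨C, hC0, hC⟩ := h.exists_integral_abs_sub_le
  set H := Real.binEntropy p with hHdef
  set n : ℝ → ℕ := fun t => ⌊H⁻¹ * t⌋₊ with hn
  have hn_top : Tendsto n atTop atTop :=
    tendsto_nat_floor_atTop.comp (tendsto_id.const_mul_atTop (inv_pos.2 hH))
  set a : ℝ := -(√H⁻¹ / H)
  set b : ℝ → ℝ := fun t => -(√(n t / t) / H)
  have hb : Tendsto b atTop (𝓝 a) :=
    ((Real.continuous_sqrt.tendsto _).comp
      (tendsto_nat_floor_mul_div_atTop (inv_nonneg.2 hH.le))).div_const H |>.neg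
  have h0 := h.tendstoSq_centered.comp_tendsto hn_top
  have h1 := h0.comp_continuous (f := fun x => a * x) (by fun_prop) (C := a ^ 2) fun x => by
    nlinarith [sq_nonneg a]
  -- Two errors vanish in mean square: the change from the limiting factor `a` to the exact `b t`,
  -- for which the main term is `-M_n / (H √t)`, and then the change from that term to the
  -- normalized passage time.
  have h2 := h1.add_error (e := fun t ω => (b t - a) * ((√(n t))⁻¹ * centered p ξ (n t) ω))
    (fun t => (h0.memLp t).const_mul _) (by
      simp_rw [mul_pow (b _ - a), integral_const_mul]
      simpa using ((hb.sub_const a).pow 2).mul h0.sq)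
  have h3 := h2.add_error (e := fun t ω => normPassage p ξ t ω - b t * ((√(n t))⁻¹ * centered p ξ (n t) ω))
    (fun t => (h.memLp_normPassage t).sub ((h0.memLp t).const_mul _)) ?_
  · have e1 : ∀ t ω, a * ((√(n t))⁻¹ * centered p ξ (n t) ω)
        + (b t - a) * ((√(n t))⁻¹ * centered p ξ (n t) ω)
        + (normPassage p ξ t ω - b t * ((√(n t))⁻¹ * centered p ξ (n t) ω)) = normPassage p ξ t ω :=
      fun t ω => by ring
    simp_rw [e1] at h3
    have e2 : ∀ z : ℝ, a * (-√(stepVar p) * z) = sigmaHat p * z := fun z => by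
      rw [h.sigmaHat_eq]; simp only [a]; ring
    simp_rw [e2] at h3
    exact h3
  · have hlim : Tendsto (fun t : ℝ => 2 * maxStep p ^ 2 / (H ^ 2 * t)
        + 2 * stepVar p * C / H ^ 2 * (√t)⁻¹) atTop (𝓝 0) := by
      have l1 : Tendsto (fun t : ℝ => 2 * maxStep p ^ 2 / (H ^ 2 * t)) atTop (𝓝 0) :=
        tendsto_const_nhds.div_atTop (tendsto_id.const_mul_atTop (by positivity))
      have l2 := (tendsto_inv_atTop_zero.comp Real.tendsto_sqrt_atTop).const_mul
        (2 * stepVar p * C / H ^ 2)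
      simpa using l1.add l2
    refine squeeze_zero' (Eventually.of_forall fun t => integral_nonneg fun ω => sq_nonneg _) ?_ hlim
    filter_upwards [eventually_ge_atTop 1] with t ht
    have ht0 : 0 < t := by linarith
    have hs : 0 < √t := Real.sqrt_pos.2 ht0
    have hss : √t ^ 2 = t := Real.sq_sqrt ht0.le
    have hpt : ∀ ω, (normPassage p ξ t ω - b t * ((√(n t))⁻¹ * centered p ξ (n t) ω)) ^ 2 ≤
        (2 * maxStep p ^ 2 + 2 * (centered p ξ (firstPassage p ξ t ω) ω - centered p ξ (n t) ω) ^ 2)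
          / (H ^ 2 * t) := by
      intro ω
      have hb' : b t * ((√(n t))⁻¹ * centered p ξ (n t) ω) = -(centered p ξ (n t) ω / (H * √t)) := by
        rcases Nat.eq_zero_or_pos (n t) with h0 | h0
        · rw [h0]; simp [centered]
        · have : 0 < √(n t : ℝ) := Real.sqrt_pos.2 (Nat.cast_pos.2 h0)
          simp only [b]
          rw [Real.sqrt_div (Nat.cast_nonneg _)]
          field_simp
      have hw1 := lt_walk_firstPassage (ξ := ξ) (ω := ω) (t := t) h.pos h.lt_one
      have hw2 := walk_firstPassage_le (ξ := ξ) (ω := ω) h.pos h.lt_one ht0.le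
      set x := walk p ξ (firstPassage p ξ t ω) ω - t with hx
      set y := centered p ξ (firstPassage p ξ t ω) ω - centered p ξ (n t) ω with hy
      -- Here `x` is the overshoot, between `0` and `maxStep`, and `y = M_ν - M_n`, whose second
      -- moment is `O(√t)`.
      have e1 : normPassage p ξ t ω - b t * ((√(n t))⁻¹ * centered p ξ (n t) ω)
          = (x - y) / (H * √t) := by
        have hc : centered p ξ (firstPassage p ξ t ω) ω =
          walk p ξ (firstPassage p ξ t ω) ω - firstPassage p ξ t ω * H := rfl
        rw [hb', normPassage, ← hHdef, hx, hy, hc]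
        field_simp
        ring
      rw [e1, div_pow, mul_pow, hss]
      refine div_le_div_of_nonneg_right ?_ (by positivity)
      have hx2 : x ^ 2 ≤ maxStep p ^ 2 := pow_le_pow_left₀ (by linarith) (by linarith) 2
      nlinarith [sq_nonneg (x + y)]
    have hWald := h.integral_sq_centered_firstPassage_sub t (n t)
    have hMint : Integrable (fun ω =>
        (centered p ξ (firstPassage p ξ t ω) ω - centered p ξ (n t) ω) ^ 2) P :=
      ((h.memLp_centered_firstPassage t).sub (h.memLp_centered (n t))).integrable_sq
    refine (integral_mono_of_nonneg (ae_of_all _ fun ω => sq_nonneg _)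
      (((integrable_const (2 * maxStep p ^ 2)).add (hMint.const_mul 2)).div_const (H ^ 2 * t))
      (ae_of_all _ hpt)).trans ?_
    rw [integral_div]
    simp only [Pi.add_apply]
    rw [integral_add (integrable_const _) (hMint.const_mul _), integral_const_mul _ (fun ω =>
      (centered p ξ (firstPassage p ξ t ω) ω - centered p ξ (n t) ω) ^ 2), hWald]
    simp only [integral_const, probReal_univ, one_smul]
    have h4 : stepVar p * ∫ ω, |(firstPassage p ξ t ω : ℝ) - n t| ∂P ≤ stepVar p * (C * √t) :=
      mul_le_mul_of_nonneg_left (hC t ht) hv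
    rw [add_div]
    have h5 : 2 * stepVar p * C / H ^ 2 * (√t)⁻¹ = 2 * (stepVar p * (C * √t)) / (H ^ 2 * t) := by
      rw [show H ^ 2 * t = H ^ 2 * √t ^ 2 by rw [hss]]; field_simp
    rw [h5]
    gcongr

end IsLetterSeq

/-! ### Deadlines at distance `√t log t` from `t / H`. -/

theorem tendsto_affine_mul_exp_neg_log_sq (A B : ℝ) {κ : ℝ} (hκ : 0 < κ) :
    Tendsto (fun t : ℝ => (A * t + B) * Real.exp (-(κ * Real.log t ^ 2))) atTop (𝓝 0) := by
  have hlim : Tendsto (fun t : ℝ => |A| * t⁻¹ + |B| * (t⁻¹ * t⁻¹)) atTop (𝓝 0) := by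
    have h := tendsto_inv_atTop_zero (𝕜 := ℝ)
    simpa using (h.const_mul |A|).add ((h.mul h).const_mul |B|)
  refine squeeze_zero_norm' ?_ hlim
  filter_upwards [eventually_gt_atTop 0, Real.tendsto_log_atTop.eventually_ge_atTop (2 / κ),
    Real.tendsto_log_atTop.eventually_ge_atTop 0] with t ht hlog hlog0
  -- Once `κ log t ≥ 2`, the exponential is at most `t⁻²`, beating any affine factor.
  have hexp : Real.exp (-(κ * Real.log t ^ 2)) ≤ t⁻¹ * t⁻¹ := by
    have h1 : 2 ≤ κ * Real.log t := by rwa [div_le_iff₀' hκ] at hlog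
    have h2 : t⁻¹ * t⁻¹ = Real.exp (-(2 * Real.log t)) := by
      rw [two_mul, neg_add, Real.exp_add, Real.exp_neg, Real.exp_log ht]
    rw [h2]
    exact Real.exp_le_exp.2 (by nlinarith)
  rw [norm_mul, Real.norm_of_nonneg (Real.exp_pos _).le, Real.norm_eq_abs]
  have h3 : |A * t + B| ≤ |A| * t + |B| := by
    refine (abs_add_le _ _).trans ?_
    rw [abs_mul, abs_of_pos ht]
  calc |A * t + B| * Real.exp (-(κ * Real.log t ^ 2)) ≤ (|A| * t + |B|) * (t⁻¹ * t⁻¹) := by gcongr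
    _ = |A| * t⁻¹ + |B| * (t⁻¹ * t⁻¹) := by field_simp

namespace IsLetterSeq

variable {Ω : Type*} [MeasurableSpace Ω] {P : Measure Ω} [IsProbabilityMeasure P] {p : ℝ}
  {ξ : ℕ → Ω → Bool}

/-- Hoeffding's inequality for the walk, on the scale `√t log t`. -/
theorem exists_tail_bound (h : IsLetterSeq P p ξ) {C : ℝ} (hC : 0 < C) :
    ∃ κ > 0, ∀ t : ℝ, 1 ≤ t → ∀ n : ℕ, 0 < n → (n : ℝ) ≤ C * t →
      P.real {ω | Real.binEntropy p * (√t * Real.log t) ≤ centered p ξ n ω}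
        ≤ Real.exp (-(κ * Real.log t ^ 2)) ∧
      P.real {ω | centered p ξ n ω ≤ -(Real.binEntropy p * (√t * Real.log t))}
        ≤ Real.exp (-(κ * Real.log t ^ 2)) := by
  have hH := entropy_pos h.pos h.lt_one
  have hM := maxStep_pos h.pos h.lt_one
  have hmean : ∀ i, ∫ ω, step p (ξ i ω) ∂P = Real.binEntropy p := fun i => by
    rw [binEntropy_eq_step]; exact h.integral_step i id
  set c : NNReal := (‖maxStep p - 0‖₊ / 2) ^ 2
  have hc : (c : ℝ) = (maxStep p / 2) ^ 2 := by
    simp [c, abs_of_pos hM]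
  have hc0 : 0 < (c : ℝ) := by rw [hc]; positivity
  have hsub : ∀ i, HasSubgaussianMGF (fun ω => step p (ξ i ω) - Real.binEntropy p) c P := fun i => by
    have := hasSubgaussianMGF_of_mem_Icc (h.measurable_step i).aemeasurable (a := 0)
      (b := maxStep p) (ae_of_all P fun ω =>
        ⟨(step_pos h.pos h.lt_one _).le, step_le_maxStep p (ξ i ω)⟩)
    rwa [hmean i] at this
  have hind : iIndepFun (fun i ω => step p (ξ i ω) - Real.binEntropy p) P :=
    h.indep.comp (fun _ b => step p b - Real.binEntropy p) fun _ => Measurable.of_discrete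
  have hind' : iIndepFun (fun i ω => -(step p (ξ i ω) - Real.binEntropy p)) P :=
    h.indep.comp (fun _ b => -(step p b - Real.binEntropy p)) fun _ => Measurable.of_discrete
  refine ⟨Real.binEntropy p ^ 2 / (2 * C * c), by positivity, fun t ht n hn hnt => ?_⟩
  have ht0 : 0 < t := by linarith
  set ε := Real.binEntropy p * (√t * Real.log t) with hε
  have hε0 : 0 ≤ ε := mul_nonneg hH.le (mul_nonneg (Real.sqrt_nonneg t) (Real.log_nonneg ht))
  have hexp : Real.exp (-ε ^ 2 / (2 * n * c)) ≤
      Real.exp (-(Real.binEntropy p ^ 2 / (2 * C * c) * Real.log t ^ 2)) := by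
    refine Real.exp_le_exp.2 ?_
    have hn0 : (0 : ℝ) < n := Nat.cast_pos.2 hn
    have e1 : Real.binEntropy p ^ 2 / (2 * C * c) * Real.log t ^ 2 = ε ^ 2 / (2 * (C * t) * c) := by
      rw [hε, mul_pow, mul_pow, Real.sq_sqrt ht0.le]
      field_simp
    rw [e1, neg_div, neg_le_neg_iff]
    gcongr
  refine ⟨le_trans ?_ hexp, le_trans ?_ hexp⟩
  · have := HasSubgaussianMGF.measure_sum_range_ge_le_of_iIndepFun hind (n := n)
      (fun i _ => hsub i) hε0
    simpa only [← centered_eq_sum] using this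
  · have := HasSubgaussianMGF.measure_sum_range_ge_le_of_iIndepFun hind' (n := n)
      (fun i _ => (hsub i).neg) hε0
    simp only [Finset.sum_neg_distrib, ← centered_eq_sum] at this
    simpa only [le_neg] using this

theorem integrable_min_firstPassage (h : IsLetterSeq P p ξ) (t : ℝ) (k : ℕ) :
    Integrable (fun ω => min (k : ℝ) (firstPassage p ξ t ω)) P :=
  (integrable_const _).inf (h.integrable_firstPassage t)

/-- A late deadline does not affect the mean. -/
theorem exists_meanPassage_sub_le (h : IsLetterSeq P p ξ) :
    ∃ r : ℝ → ℝ, Tendsto r atTop (𝓝 0) ∧ ∀ t : ℝ, 1 ≤ t → ∀ K : ℕ,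
      t / Real.binEntropy p + √t * Real.log t ≤ K →
      |meanPassage P p ξ t - ∫ ω, min ((K + 1 : ℕ) : ℝ) (firstPassage p ξ t ω) ∂P| ≤ r t := by
  have hH := entropy_pos h.pos h.lt_one
  have hm := minStep_pos h.pos h.lt_one
  set H := Real.binEntropy p with hHdef
  obtain ⟨κ, hκ, hκb⟩ := h.exists_tail_bound (C := 1 / H + 3) (by positivity)
  refine ⟨fun t => ((minStep p)⁻¹ * t + 1) * Real.exp (-(κ * Real.log t ^ 2)),
    tendsto_affine_mul_exp_neg_log_sq _ _ hκ, fun t ht K hK => ?_⟩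
  have ht0 : 0 < t := by linarith
  have hlog : 0 ≤ Real.log t := Real.log_nonneg ht
  have hsl : 0 ≤ √t * Real.log t := mul_nonneg (Real.sqrt_nonneg t) hlog
  set x := t / H + √t * Real.log t with hx
  have hx0 : 0 < x := by positivity
  -- The tail bound is applied at this `n ≤ K`, which is of order `t`, and not at `K`, which may be
  -- far larger. The constant `1 / H + 3` comes from `log t ≤ 2√t` and the rounding.
  set n := ⌈x⌉₊ with hn
  have hnK : n ≤ K := Nat.ceil_le.2 hK
  have hxn : x ≤ n := Nat.le_ceil x
  have hnx : (n : ℝ) < x + 1 := Nat.ceil_lt_add_one hx0.le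
  have hn0 : 0 < n := Nat.ceil_pos.2 hx0
  have hnC : (n : ℝ) ≤ (1 / H + 3) * t := by
    have h1 : Real.log t ≤ 2 * √t := by
      have := Real.log_le_self (Real.sqrt_nonneg t)
      rw [Real.log_sqrt ht0.le] at this
      linarith
    have h2 : √t * Real.log t ≤ √t * (2 * √t) := by gcongr
    have h3 : √t * (2 * √t) = 2 * t := by linear_combination 2 * Real.mul_self_sqrt ht0.le
    have h4 : (1 / H + 3) * t = t / H + 3 * t := by ring
    linarith
  have hprob := (hκb t ht n hn0 hnC).2
  set A := {ω | centered p ξ n ω ≤ -(H * (√t * Real.log t))} with hA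
  have hAm : MeasurableSet A := by
    refine measurableSet_le ?_ measurable_const
    exact ((prefixDetermined_walk (ξ := ξ) (n := n) p).measurable h.meas).sub_const _
  have hpt : ∀ ω, (firstPassage p ξ t ω : ℝ) - min ((K + 1 : ℕ) : ℝ) (firstPassage p ξ t ω) ≤
      A.indicator (fun _ => t / minStep p + 1) ω := by
    intro ω
    by_cases hω : ω ∈ A
    · rw [Set.indicator_of_mem hω]
      have h1 : (firstPassage p ξ t ω : ℝ) ≤ t / minStep p + 1 :=
        (Nat.cast_le.2 (firstPassage_le_passageBound h.pos h.lt_one)).trans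
          (passageBound_le h.pos h.lt_one ht0.le)
      have h2 : 0 ≤ min ((K + 1 : ℕ) : ℝ) (firstPassage p ξ t ω) :=
        le_min (Nat.cast_nonneg _) (Nat.cast_nonneg _)
      linarith
    · rw [Set.indicator_of_notMem hω]
      -- Off the rare event the walk has crossed `t` by time `n ≤ K`, so the deadline has no effect;
      -- on it `ν` is at most linear in `t`.
      have h1 : t < walk p ξ n ω := by
        by_contra hc
        refine hω ?_
        simp only [hA, Set.mem_ofPred_eq, centered, ← hHdef]
        have : H * x ≤ n * H := by nlinarith
        have e : H * x = t + H * (√t * Real.log t) := by rw [hx]; field_simp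
        linarith [not_lt.1 hc]
      have h2 : firstPassage p ξ t ω ≤ K + 1 := by
        by_contra hc
        have : n < firstPassage p ξ t ω := by omega
        linarith [(lt_firstPassage_iff h.pos h.lt_one).1 this]
      rw [min_eq_right (Nat.cast_le.2 h2), sub_self]
  rw [meanPassage, ← integral_sub (h.integrable_firstPassage t)
    (h.integrable_min_firstPassage t (K + 1)), abs_of_nonneg
    (integral_nonneg fun ω => sub_nonneg.2 (min_le_right _ _))]
  refine (integral_mono_of_nonneg (ae_of_all _ fun ω => sub_nonneg.2 (min_le_right _ _))
    ((integrable_const _).indicator hAm) (ae_of_all _ hpt)).trans ?_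
  rw [integral_indicator_const _ hAm, smul_eq_mul, mul_comm, div_eq_inv_mul]
  exact mul_le_mul_of_nonneg_left hprob (by positivity)

/-- An early deadline is met with probability close to one. -/
theorem exists_deadline_sub_le (h : IsLetterSeq P p ξ) :
    ∃ r : ℝ → ℝ, Tendsto r atTop (𝓝 0) ∧ ∀ t : ℝ, 1 ≤ t → ∀ K : ℕ, 0 < K →
      (K : ℝ) ≤ t / Real.binEntropy p - √t * Real.log t →
      |∫ ω, min ((K + 1 : ℕ) : ℝ) (firstPassage p ξ t ω) ∂P - (K + 1)| ≤ r t := by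
  have hH := entropy_pos h.pos h.lt_one
  set H := Real.binEntropy p with hHdef
  obtain ⟨κ, hκ, hκb⟩ := h.exists_tail_bound (C := H⁻¹) (by positivity)
  refine ⟨fun t => (H⁻¹ * t + 1) * Real.exp (-(κ * Real.log t ^ 2)),
    tendsto_affine_mul_exp_neg_log_sq _ _ hκ, fun t ht K hK0 hK => ?_⟩
  have ht0 : 0 < t := by linarith
  have hsl : 0 ≤ √t * Real.log t := mul_nonneg (Real.sqrt_nonneg t) (Real.log_nonneg ht)
  have hKC : (K : ℝ) ≤ H⁻¹ * t := by rw [← div_eq_inv_mul]; linarith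
  have hprob := (hκb t ht K hK0 hKC).1
  set A := {ω | H * (√t * Real.log t) ≤ centered p ξ K ω} with hA
  have hAm : MeasurableSet A := by
    refine measurableSet_le measurable_const ?_
    exact ((prefixDetermined_walk (ξ := ξ) (n := K) p).measurable h.meas).sub_const _
  have hpt : ∀ ω, ((K : ℝ) + 1) - min ((K + 1 : ℕ) : ℝ) (firstPassage p ξ t ω) ≤
      A.indicator (fun _ => (K : ℝ) + 1) ω := by
    intro ω
    by_cases hω : ω ∈ A
    · rw [Set.indicator_of_mem hω]
      have h2 : 0 ≤ min ((K + 1 : ℕ) : ℝ) (firstPassage p ξ t ω) :=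
        le_min (Nat.cast_nonneg _) (Nat.cast_nonneg _)
      linarith
    · rw [Set.indicator_of_notMem hω]
      have h1 : walk p ξ K ω ≤ t := by
        by_contra hc
        refine hω ?_
        simp only [hA, Set.mem_ofPred_eq, centered, ← hHdef]
        have : K * H ≤ H * (t / H - √t * Real.log t) := by nlinarith
        have e : H * (t / H - √t * Real.log t) = t - H * (√t * Real.log t) := by field_simp
        linarith [not_le.1 hc]
      have h2 : K + 1 ≤ firstPassage p ξ t ω := (lt_firstPassage_iff h.pos h.lt_one).2 h1
      rw [min_eq_left (Nat.cast_le.2 h2)]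
      push_cast
      linarith
  have hnn : ∀ ω, 0 ≤ ((K : ℝ) + 1) - min ((K + 1 : ℕ) : ℝ) (firstPassage p ξ t ω) := fun ω => by
    have := min_le_left ((K + 1 : ℕ) : ℝ) (firstPassage p ξ t ω)
    push_cast at this ⊢
    linarith
  have hconst : ∫ _, ((K : ℝ) + 1) ∂P = K + 1 := by simp
  rw [abs_sub_comm, ← hconst, ← integral_sub (integrable_const _)
    (h.integrable_min_firstPassage t (K + 1)), abs_of_nonneg (integral_nonneg hnn)]
  refine (integral_mono_of_nonneg (ae_of_all _ hnn)
    ((integrable_const _).indicator hAm) (ae_of_all _ hpt)).trans ?_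
  rw [integral_indicator_const _ hAm, smul_eq_mul, mul_comm]
  exact mul_le_mul (by linarith) hprob measureReal_nonneg (by positivity)

end IsLetterSeq

/-! ### Truncated normal moments and `Ψ`. -/

section Gaussian

theorem integrable_id_gaussianReal : Integrable (fun z : ℝ => z) (gaussianReal 0 1) :=
  (memLp_id_gaussianReal' 1 (by simp)).integrable le_rfl

theorem integrable_max_sub_gaussianReal (a b : ℝ) :
    Integrable (fun z : ℝ => max (a - b * z) 0) (gaussianReal 0 1) :=
  ((integrable_const a).sub (integrable_id_gaussianReal.const_mul b)).sup (integrable_const 0)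

/-- The layer-cake formula for `(x - Z)⁺`, followed by the reflection `y = x - s`. -/
theorem Psi_eq_integral (x : ℝ) : Psi x = ∫ z, max (x - z) 0 ∂gaussianReal 0 1 := by
  have hint := integrable_max_sub_gaussianReal x 1
  simp only [one_mul] at hint
  rw [hint.integral_eq_integral_meas_le (ae_of_all _ fun z => le_max_right _ _)]
  have h1 : ∫ s in Set.Ioi (0 : ℝ), (gaussianReal 0 1).real {z | s ≤ max (x - z) 0} =
      ∫ s in Set.Ici (0 : ℝ), cdf (gaussianReal 0 1) (x - s) := by
    rw [integral_Ici_eq_integral_Ioi]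
    refine setIntegral_congr_fun measurableSet_Ioi fun s hs => ?_
    rw [cdf_eq_real]
    congr 1
    ext z
    have hs' : 0 < s := hs
    simp only [Set.mem_ofPred_eq, Set.mem_Iic, le_max_iff, not_le.2 hs', or_false]
    constructor <;> intro _ <;> linarith
  rw [h1, Psi, ← integral_indicator measurableSet_Iic, ← integral_indicator measurableSet_Ici,
    ← integral_sub_left_eq_self _ volume x]
  congr 1
  ext s
  simp only [Set.indicator_apply, Set.mem_Iic, Set.mem_Ici, sub_le_self_iff]

theorem integral_comp_neg_gaussianReal (f : ℝ → ℝ) (hf : Continuous f) :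
    ∫ z, f (-z) ∂gaussianReal 0 1 = ∫ z, f z ∂gaussianReal 0 1 := by
  have h := gaussianReal_map_neg (μ := 0) (v := 1)
  rw [neg_zero] at h
  nth_rw 2 [← h]
  rw [integral_map (by fun_prop) hf.aestronglyMeasurable]

theorem integral_min_mul_gaussianReal {σ : ℝ} (hσ : 0 < σ) (r : ℝ) :
    ∫ z, min (σ * z) r ∂gaussianReal 0 1 = r - σ * Psi (r / σ) := by
  have h1 : ∀ z : ℝ, min (σ * z) r = r - σ * max (r / σ - z) 0 := fun z => by
    rcases le_total (σ * z) r with hle | hle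
    · have hz : z ≤ r / σ := (le_div_iff₀' hσ).2 hle
      rw [min_eq_left hle, max_eq_left (sub_nonneg.2 hz)]
      field_simp
      ring
    · have hz : r / σ ≤ z := (div_le_iff₀' hσ).2 hle
      rw [min_eq_right hle, max_eq_right (sub_nonpos.2 hz), mul_zero, sub_zero]
  have hint := (integrable_max_sub_gaussianReal (r / σ) 1).const_mul σ
  simp only [one_mul] at hint
  simp_rw [h1]
  rw [integral_sub (integrable_const _) hint, integral_const_mul, Psi_eq_integral]
  simp

/-- Here the cut is taken off `σ Z`, as `σ (Z - r/σ)⁺`, instead of off `r`; symmetry and `E Z = 0`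
give the expansion around `V₂ / H`. -/
theorem integral_min_mul_gaussianReal' {σ : ℝ} (hσ : 0 < σ) (r : ℝ) :
    ∫ z, min (σ * z) r ∂gaussianReal 0 1 = -(σ * Psi (-r / σ)) := by
  have h1 : ∀ z : ℝ, min (σ * z) r = σ * z - σ * max (-r / σ - (-z)) 0 := fun z => by
    rw [sub_neg_eq_add, neg_div]
    rcases le_total (σ * z) r with hle | hle
    · have hz : z ≤ r / σ := (le_div_iff₀' hσ).2 hle
      rw [min_eq_left hle, max_eq_right (by linarith), mul_zero, sub_zero]
    · have hz : r / σ ≤ z := (div_le_iff₀' hσ).2 hle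
      rw [min_eq_right hle, max_eq_left (by linarith)]
      field_simp
      ring
  have hint := (integrable_max_sub_gaussianReal (-r / σ) (-1)).const_mul σ
  simp only [neg_one_mul] at hint
  simp_rw [h1]
  rw [integral_sub (integrable_id_gaussianReal.const_mul σ) hint, integral_const_mul,
    integral_const_mul, Psi_eq_integral,
    integral_comp_neg_gaussianReal (fun z => max (-r / σ - z) 0) (by fun_prop),
    integral_id_gaussianReal]
  simp

theorem memLp_mul_gaussianReal (σ : ℝ) : MemLp (fun z : ℝ => σ * z) 2 (gaussianReal 0 1) :=
  MemLp.const_mul (f := fun z : ℝ => z) (memLp_id_gaussianReal' 2 (by simp)) _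

theorem variance_mul_gaussianReal (σ : ℝ) : Var[fun z : ℝ => σ * z; gaussianReal 0 1] = σ ^ 2 := by
  rw [variance_const_mul, variance_fun_id_gaussianReal]
  simp

/-- Needed to turn a limit of normalized variances into `~`. Zero variance would make a continuous
function constant almost everywhere, hence everywhere by full support of the Gaussian; the points `a
/ σ` and `(a - 1) / σ` refute this. -/
theorem variance_min_mul_gaussianReal_ne_zero {σ : ℝ} (hσ : 0 < σ) (a : ℝ) :
    Var[fun z : ℝ => min (σ * z) a; gaussianReal 0 1] ≠ 0 := by
  intro h0
  have hmem : MemLp (fun z : ℝ => min (σ * z) a) 2 (gaussianReal 0 1) :=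
    (memLp_mul_gaussianReal σ).inf (memLp_const a)
  have hae := ae_eq_integral_of_variance_eq_zero hmem h0
  have : (gaussianReal 0 1).IsOpenPosMeasure :=
    (gaussianReal_absolutelyContinuous' 0 one_ne_zero).isOpenPosMeasure
  set c := ∫ z, min (σ * z) a ∂gaussianReal 0 1
  have heq : (fun z : ℝ => min (σ * z) a) = fun _ => c :=
    Continuous.ae_eq_iff_eq (gaussianReal 0 1) (by fun_prop) continuous_const |>.1 hae
  have e1 := congrFun heq (a / σ)
  have e2 := congrFun heq ((a - 1) / σ)
  simp only [mul_div_cancel₀ _ hσ.ne', min_self] at e1 e2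
  rw [min_eq_left (by linarith)] at e2
  linarith

end Gaussian

/-! ### Truncation at a level that need not converge. -/

theorem tendstoSq_const {Ω' ι : Type*} [MeasurableSpace Ω'] {P' : Measure Ω'}
    [IsProbabilityMeasure P'] {Z : Ω' → ℝ} (hZ : MemLp Z 2 P') (l : Filter ι) :
    TendstoSq (fun _ : ι => Z) l Z P' P' where
  dist := tendstoInDistribution_const hZ.aestronglyMeasurable.aemeasurable
  memLp _ := hZ
  memLp_limit := hZ
  sq := tendsto_const_nhds

theorem sq_integral_le {Ω : Type*} [MeasurableSpace Ω] {P : Measure Ω} [IsProbabilityMeasure P]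
    {X : Ω → ℝ} (hX : MemLp X 2 P) : (∫ ω, X ω ∂P) ^ 2 ≤ ∫ ω, X ω ^ 2 ∂P := by
  have := variance_nonneg X P
  rw [variance_eq_sub hX] at this
  simp only [Pi.pow_apply] at this
  linarith

namespace TendstoSq

variable {Ω Ω' ι : Type*} [MeasurableSpace Ω] [MeasurableSpace Ω'] {W : ι → Ω → ℝ} {l : Filter ι}
  {Z : Ω' → ℝ} {P : Measure Ω} {P' : Measure Ω'} [IsProbabilityMeasure P] [IsProbabilityMeasure P']

theorem integral_min_sub_atBot (h : TendstoSq W l Z P P') {r : ι → ℝ} (hr : Tendsto r l atBot) :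
    Tendsto (fun i => ∫ ω, min (W i ω) (r i) ∂P - r i) l (𝓝 0) := by
  have hlim := (Real.continuous_sqrt.tendsto 0).comp (h.integral_sq_min_sub_atBot hr)
  rw [Real.sqrt_zero] at hlim
  refine squeeze_zero_norm (fun i => ?_) hlim
  have hm : MemLp (fun ω => min (W i ω) (r i) - r i) 2 P :=
    (h.memLp_min i (r i)).sub (memLp_const (r i))
  have hle := sq_integral_le hm
  rw [integral_sub ((h.memLp_min i (r i)).integrable (by norm_num)) (integrable_const _)] at hle
  simp only [integral_const, probReal_univ, one_smul] at hle
  exact Real.abs_le_sqrt hle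

/-- The mean of a quadratically convergent family truncated from above, whatever the level. -/
theorem tendsto_integral_min_sub (h : TendstoSq W l Z P P') {r s : ι → ℝ}
    (hrs : Tendsto (fun i => r i - s i) l (𝓝 0)) :
    Tendsto (fun i => ∫ ω, min (W i ω) (r i) ∂P - ∫ ω, min (Z ω) (s i) ∂P') l (𝓝 0) := by
  rw [tendsto_iff_ultrafilter]
  intro u hu
  have hW : TendstoSq W (u : Filter ι) Z P P' := h.comp_tendsto (φ := id) hu
  have hZ : TendstoSq (fun _ => Z) (u : Filter ι) Z P' P' := tendstoSq_const h.memLp_limit _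
  have hrs' := hrs.mono_left hu
  -- Along an ultrafilter the level converges in the compact extended line, leaving the three
  -- truncation regimes. They apply both to `W` and to the constant family `Z`.
  obtain ⟨a, -, ha⟩ := isCompact_univ.ultrafilter_le_nhds (u.map fun i => (s i : EReal)) (by simp)
  have ha : Tendsto (fun i => (s i : EReal)) u (𝓝 a) := ha
  induction a with
  | bot =>
    have hs : Tendsto s u atBot := EReal.tendsto_coe_nhds_bot_iff.1 ha
    have hr : Tendsto r u atBot := by simpa using hrs'.add_atBot hs
    have := ((hW.integral_min_sub_atBot hr).sub (hZ.integral_min_sub_atBot hs)).add hrs'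
    simp only [sub_zero, add_zero] at this
    exact this.congr fun i => by ring
  | top =>
    have hs : Tendsto s u atTop := EReal.tendsto_coe_nhds_top_iff.1 ha
    have hr : Tendsto r u atTop := by simpa using hrs'.add_atTop hs
    simpa using (hW.min_atTop hr).integral.sub (hZ.min_atTop hs).integral
  | coe a =>
    have hs : Tendsto s u (𝓝 a) := EReal.tendsto_coe.1 ha
    have hr : Tendsto r u (𝓝 a) := by simpa using hrs'.add hs
    simpa using (hW.min_nhds hr).integral.sub (hZ.min_nhds hs).integral

end TendstoSq

/-! ### The stopped passage time in the three regimes. -/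

/-- The passage time stopped at `K + 1`. -/
noncomputable def stopped {Ω : Type*} (p : ℝ) (ξ : ℕ → Ω → Bool) (t : ℝ) (K : ℕ) (ω : Ω) : ℝ :=
  min ((K + 1 : ℕ) : ℝ) (firstPassage p ξ t ω)

/-- The deadline `k` in the normalization of the passage time. -/
noncomputable def normDeadline (p t k : ℝ) : ℝ := (k - t / Real.binEntropy p) / √t

theorem norm_stopped {Ω : Type*} (p : ℝ) (ξ : ℕ → Ω → Bool) (t : ℝ) (K : ℕ) (ω : Ω) :
    (stopped p ξ t K ω - t / Real.binEntropy p) / √t =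
      min (IsLetterSeq.normPassage p ξ t ω) (normDeadline p t (K + 1 : ℕ)) := by
  rw [IsLetterSeq.normPassage, normDeadline, min_div_div_right (Real.sqrt_nonneg t), stopped,
    min_comm, ← min_sub_sub_right]

theorem stopped_eq {Ω : Type*} (p : ℝ) (ξ : ℕ → Ω → Bool) {t : ℝ} (ht : 0 < t) (K : ℕ) (ω : Ω) :
    stopped p ξ t K ω = √t * min (IsLetterSeq.normPassage p ξ t ω)
      (normDeadline p t (K + 1 : ℕ)) + t / Real.binEntropy p := by
  have hs : √t ≠ 0 := (Real.sqrt_pos.2 ht).ne'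
  rw [← norm_stopped, mul_div_cancel₀ _ hs]
  ring

namespace IsLetterSeq

variable {Ω ι : Type*} [MeasurableSpace Ω] {P : Measure Ω} [IsProbabilityMeasure P] {p : ℝ}
  {ξ : ℕ → Ω → Bool} {l : Filter ι} {t : ι → ℝ} {K : ι → ℕ}

theorem sigmaHat_pos (h : IsLetterSeq P p ξ) (hpq : p ≠ 1 - p) : 0 < sigmaHat p := by
  have hH := entropy_pos h.pos h.lt_one
  have hv := stepVar_pos h.pos h.lt_one hpq
  rw [h.sigmaHat_eq]
  positivity

theorem memLp_min_normPassage (h : IsLetterSeq P p ξ) (t r : ℝ) :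
    MemLp (fun ω => min (normPassage p ξ t ω) r) 2 P :=
  h.tendstoSq_normPassage.memLp_min t r

theorem integral_stopped (h : IsLetterSeq P p ξ) {t : ℝ} (ht : 0 < t) (K : ℕ) :
    ∫ ω, stopped p ξ t K ω ∂P = √t * ∫ ω, min (normPassage p ξ t ω)
      (normDeadline p t (K + 1 : ℕ)) ∂P + t / Real.binEntropy p := by
  simp_rw [stopped_eq p ξ ht]
  rw [integral_add (((h.memLp_min_normPassage t _).integrable (by norm_num)).const_mul _)
    (integrable_const _), integral_const_mul]
  simp

theorem variance_stopped (h : IsLetterSeq P p ξ) {t : ℝ} (ht : 0 < t) (K : ℕ) :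
    Var[stopped p ξ t K; P] = t * Var[fun ω => min (normPassage p ξ t ω)
      (normDeadline p t (K + 1 : ℕ)); P] := by
  have : stopped p ξ t K = fun ω => √t * min (normPassage p ξ t ω)
      (normDeadline p t (K + 1 : ℕ)) + t / Real.binEntropy p := funext fun ω => stopped_eq p ξ ht K ω
  rw [this, variance_add_const ((h.memLp_min_normPassage t _).aestronglyMeasurable.const_mul _),
    variance_const_mul, Real.sq_sqrt ht.le]

/-- The truncation happens at `K + 1` while the regimes are stated with `K`; the discrepancy is `1 /
√t`. -/
theorem tendsto_normDeadline_succ_sub (ht : Tendsto t l atTop) :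
    Tendsto (fun i => normDeadline p (t i) (K i + 1 : ℕ) - normDeadline p (t i) (K i)) l (𝓝 0) := by
  refine ((tendsto_inv_atTop_zero.comp Real.tendsto_sqrt_atTop).comp ht).congr fun i => ?_
  simp only [Function.comp_apply, normDeadline]
  push_cast
  ring

theorem tendstoSq_normPassage_comp (h : IsLetterSeq P p ξ) (ht : Tendsto t l atTop) :
    TendstoSq (fun i => normPassage p ξ (t i)) l (fun z : ℝ => sigmaHat p * z) P
      (gaussianReal 0 1) := h.tendstoSq_normPassage.comp_tendsto ht

/-- The asymptotically normal regime. -/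
theorem stopped_atTop (h : IsLetterSeq P p ξ) (hpq : p ≠ 1 - p) (ht : Tendsto t l atTop)
    (hR : Tendsto (fun i => normDeadline p (t i) (K i)) l atTop) :
    TendstoInDistribution (fun i ω => (stopped p ξ (t i) (K i) ω - t i / Real.binEntropy p)
        / √(sigmaHat p ^ 2 * t i)) l (fun z : ℝ => z) (fun _ => P) (gaussianReal 0 1) ∧
      (fun i => Var[stopped p ξ (t i) (K i); P]) ~[l] fun i => sigmaHat p ^ 2 * t i := by
  have hσ := h.sigmaHat_pos hpq
  have hr : Tendsto (fun i => normDeadline p (t i) (K i + 1 : ℕ)) l atTop := by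
    simpa using (tendsto_normDeadline_succ_sub (p := p) (K := K) ht).add_atTop hR
  have hT := (h.tendstoSq_normPassage_comp ht).min_atTop hr
  constructor
  · have hc := hT.dist.continuous_comp (g := fun x => x / sigmaHat p) (by fun_prop)
    refine hc.congr (fun i => ae_of_all _ fun ω => ?_) (ae_of_all _ fun z => ?_)
    · simp only [Function.comp_apply]
      rw [← norm_stopped, Real.sqrt_mul (sq_nonneg _), Real.sqrt_sq hσ.le, div_div, mul_comm]
    · simp only [Function.comp_apply]
      field_simp
  · have hV := hT.variance
    rw [variance_mul_gaussianReal] at hV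
    have hE := ((isEquivalent_const_iff_tendsto (pow_ne_zero 2 hσ.ne')).2 hV).mul
      (IsEquivalent.refl (u := t) (l := l))
    refine hE.congr_left ?_
    filter_upwards [ht.eventually_gt_atTop 0] with i hi
    rw [Pi.mul_apply, h.variance_stopped hi, mul_comm]

/-- The asymptotically degenerate regime. -/
theorem stopped_atBot (h : IsLetterSeq P p ξ) (ht : Tendsto t l atTop)
    (hR : Tendsto (fun i => normDeadline p (t i) (K i)) l atBot) :
    Tendsto (fun i => P {ω | stopped p ξ (t i) (K i) ω = (K i : ℝ) + 1}) l (𝓝 1) ∧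
      (fun i => Var[stopped p ξ (t i) (K i); P]) =o[l] t := by
  have hr : Tendsto (fun i => normDeadline p (t i) (K i + 1 : ℕ)) l atBot := by
    simpa using (tendsto_normDeadline_succ_sub (p := p) (K := K) ht).add_atBot hR
  have hT := h.tendstoSq_normPassage_comp ht
  constructor
  · set A : ι → Set Ω := fun i => {ω | stopped p ξ (t i) (K i) ω = (K i : ℝ) + 1}
    have hmeas : ∀ i, MeasurableSet (A i) := fun i =>
      measurableSet_eq_fun (measurable_const.min (h.measurable_firstPassage (t i))) measurable_const
    have hbound : ∀ᶠ i in l, 1 - (∫ ω, normPassage p ξ (t i) ω ^ 2 ∂P) *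
        (normDeadline p (t i) (K i + 1 : ℕ) ^ 2)⁻¹ ≤ P.real (A i) := by
      filter_upwards [ht.eventually_gt_atTop 0, hr.eventually_lt_atBot 0] with i hi hri
      set r := normDeadline p (t i) (K i + 1 : ℕ) with hrdef
      have hs : 0 < √(t i) := Real.sqrt_pos.2 hi
      have hr2 : 0 < r ^ 2 := by nlinarith
      -- Missing `K + 1` forces `W < r < 0`, hence `W² ≥ r²`, and Chebyshev's inequality applies
      -- with bounded second moments.
      have hsub : (A i)ᶜ ⊆ {ω | r ^ 2 ≤ normPassage p ξ (t i) ω ^ 2} := by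
        intro ω hω
        by_contra hc
        refine hω ?_
        have hlt : r ≤ normPassage p ξ (t i) ω := by
          by_contra hlt
          refine hc ?_
          simp only [Set.mem_ofPred_eq]
          nlinarith [not_le.1 hlt]
        have hst := stopped_eq p ξ hi (K i) ω
        rw [← hrdef, min_eq_right hlt, hrdef, normDeadline, mul_div_cancel₀ _ hs.ne'] at hst
        simp only [A, Set.mem_ofPred_eq]
        rw [hst]
        push_cast
        ring
      have hcheb := mul_meas_ge_le_integral_of_nonneg
        (ae_of_all P fun ω => sq_nonneg (normPassage p ξ (t i) ω))
        (h.memLp_normPassage (t i)).integrable_sq (r ^ 2)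
      have hle : P.real (A i)ᶜ ≤ (∫ ω, normPassage p ξ (t i) ω ^ 2 ∂P) * (r ^ 2)⁻¹ := by
        rw [← div_eq_mul_inv, le_div_iff₀ hr2, mul_comm]
        exact (mul_le_mul_of_nonneg_left (measureReal_mono hsub) hr2.le).trans hcheb
      rw [probReal_compl_eq_one_sub (hmeas i)] at hle
      linarith
    have hlow : Tendsto (fun i => 1 - (∫ ω, normPassage p ξ (t i) ω ^ 2 ∂P) *
        (normDeadline p (t i) (K i + 1 : ℕ) ^ 2)⁻¹) l (𝓝 1) := by
      have hsq : Tendsto (fun i => normDeadline p (t i) (K i + 1 : ℕ) ^ 2) l atTop := by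
        have := (tendsto_pow_atTop two_ne_zero).comp (tendsto_abs_atBot_atTop.comp hr)
        exact this.congr fun i => sq_abs _
      simpa using (hT.sq.mul (tendsto_inv_atTop_zero.comp hsq)).const_sub 1
    have hreal : Tendsto (fun i => P.real (A i)) l (𝓝 1) :=
      tendsto_of_tendsto_of_tendsto_of_le_of_le' hlow tendsto_const_nhds hbound
        (Eventually.of_forall fun i => measureReal_le_one)
    have := ENNReal.tendsto_ofReal hreal
    simpa [ofReal_measureReal] using this
  · have hV : Tendsto (fun i => Var[fun ω => min (normPassage p ξ (t i) ω)
        (normDeadline p (t i) (K i + 1 : ℕ)); P]) l (𝓝 0) := by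
      refine squeeze_zero (fun i => variance_nonneg _ _) (fun i => ?_)
        (hT.integral_sq_min_sub_atBot hr)
      have hm := (h.memLp_min_normPassage (t i)
        (normDeadline p (t i) (K i + 1 : ℕ))).aestronglyMeasurable
      rw [← variance_sub_const hm (normDeadline p (t i) (K i + 1 : ℕ))]
      exact variance_le_expectation_sq (hm.sub aestronglyMeasurable_const)
    have hO := ((isLittleO_one_iff ℝ).2 hV).mul_isBigO (isBigO_refl t l)
    refine hO.congr' ?_ (Eventually.of_forall fun i => one_mul _)
    filter_upwards [ht.eventually_gt_atTop 0] with i hi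
    rw [h.variance_stopped hi, mul_comm]

/-- The asymptotically truncated normal regime. -/
theorem stopped_nhds (h : IsLetterSeq P p ξ) (hpq : p ≠ 1 - p) (ht : Tendsto t l atTop) {a : ℝ}
    (hR : Tendsto (fun i => normDeadline p (t i) (K i)) l (𝓝 a)) :
    TendstoInDistribution (fun i ω => (stopped p ξ (t i) (K i) ω - t i / Real.binEntropy p)
        / √(t i)) l (fun z : ℝ => min (sigmaHat p * z) a) (fun _ => P) (gaussianReal 0 1) ∧
      (fun i => Var[stopped p ξ (t i) (K i); P]) ~[l]
        fun i => t i * Var[fun z : ℝ => min (sigmaHat p * z) a; gaussianReal 0 1] := by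
  have hr : Tendsto (fun i => normDeadline p (t i) (K i + 1 : ℕ)) l (𝓝 a) := by
    simpa using (tendsto_normDeadline_succ_sub (p := p) (K := K) ht).add hR
  have hT := (h.tendstoSq_normPassage_comp ht).min_nhds hr
  constructor
  · simp_rw [norm_stopped]
    exact hT.dist
  · have hE := (IsEquivalent.refl (u := t) (l := l)).mul ((isEquivalent_const_iff_tendsto
      (variance_min_mul_gaussianReal_ne_zero (h.sigmaHat_pos hpq) a)).2 hT.variance)
    refine hE.congr_left ?_
    filter_upwards [ht.eventually_gt_atTop 0] with i hi
    rw [Pi.mul_apply, h.variance_stopped hi]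

/-- The mean of the stopped passage time, in all regimes. -/
theorem integral_stopped_isLittleO (h : IsLetterSeq P p ξ) (ht : Tendsto t l atTop) :
    (fun i => ∫ ω, stopped p ξ (t i) (K i) ω ∂P - (t i / Real.binEntropy p + √(t i) *
      ∫ z, min (sigmaHat p * z) (normDeadline p (t i) (K i)) ∂gaussianReal 0 1))
        =o[l] fun i => √(t i) := by
  have hlim := (h.tendstoSq_normPassage_comp ht).tendsto_integral_min_sub
    (tendsto_normDeadline_succ_sub (p := p) (K := K) ht)
  have hO := (isBigO_refl (fun i => √(t i)) l).mul_isLittleO ((isLittleO_one_iff ℝ).2 hlim)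
  refine hO.congr' ?_ (Eventually.of_forall fun i => mul_one _)
  filter_upwards [ht.eventually_gt_atTop 0] with i hi
  rw [h.integral_stopped hi]
  ring

end IsLetterSeq

end StoppedWalk

/-! ### Assembly of the theorem. -/

open StoppedWalk in
theorem mainTheorem7 {Ω : Type*} [MeasurableSpace Ω] (P : Measure Ω) [IsProbabilityMeasure P]
    (p : ℝ) (hp0 : 0 < p) (hp1 : p < 1) (hpq : p ≠ 1 - p)
    (ξ : ℕ → Ω → Bool) (hmeas : ∀ i, Measurable (ξ i)) (hindep : iIndepFun ξ P)
    (hlaw : ∀ i, P {ω | ξ i ω = true} = ENNReal.ofReal p)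
    {ι : Type*} (l : Filter ι) (V : ι → ℝ) (K : ι → ℕ)
    (hV : Tendsto V l atTop) (hK : Tendsto K l atTop)
    (H H₂ σ : ℝ) (hH : H = Real.binEntropy p) (hH₂ : H₂ = StoppedWalk.secondMoment p)
    (hσ : σ = StoppedWalk.sigmaHat p)
    (V₂ : ι → ℝ) (hV₂ : ∀ i, V₂ i = V i * Real.log 2)
    (D : ι → Ω → ℝ) (hD : ∀ i ω, D i ω = StoppedWalk.exitTime p ξ (V i) (K i) ω)
    (R : ι → ℝ) (hR : ∀ i, R i = ((K i : ℝ) - V₂ i / H) / Real.sqrt (V₂ i)) :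
    0 < StoppedWalk.sigmaHatSq p ∧
    -- asymptotically normal regime
    (Tendsto R l atTop →
      TendstoInDistribution (fun i ω => (D i ω - V₂ i / H) / Real.sqrt (σ ^ 2 * V₂ i)) l
        (fun z : ℝ => z) (fun _ => P) (gaussianReal 0 1) ∧
      (fun i => Var[D i; P]) ~[l] fun i => σ ^ 2 * V₂ i) ∧
    -- asymptotically degenerate regime
    (Tendsto R l atBot →
      Tendsto (fun i => P {ω | D i ω = (K i : ℝ) + 1}) l (𝓝 1) ∧
      (fun i => Var[D i; P]) =o[l] V₂) ∧
    -- asymptotically truncated normal regime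
    (∀ a : ℝ, Tendsto R l (𝓝 a) →
      TendstoInDistribution (fun i ω => (D i ω - V₂ i / H) / Real.sqrt (V₂ i)) l
        (fun z : ℝ => min (σ * z) a) (fun _ => P) (gaussianReal 0 1) ∧
      (∀ z : ℝ, min (σ * z) a = σ * min z (a / σ)) ∧
      ((fun i => Var[D i; P]) ~[l]
        fun i => V₂ i * Var[fun z : ℝ => min (σ * z) a; gaussianReal 0 1]) ∧
      ((fun i => Var[D i; P]) ~[l]
        fun i => V₂ i * σ ^ 2 * Var[fun z : ℝ => min z (a / σ); gaussianReal 0 1])) ∧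
    -- the mean, in every case
    ((fun i => (∫ ω, D i ω ∂P) - (V₂ i / H - σ * Real.sqrt (V₂ i) *
        StoppedWalk.Psi ((V₂ i / H - (K i : ℝ)) / (σ * Real.sqrt (V₂ i)))))
      =o[l] fun i => Real.sqrt (V₂ i)) ∧
    ((fun i => (∫ ω, D i ω ∂P) - ((K i : ℝ) - σ * Real.sqrt (V₂ i) *
        StoppedWalk.Psi (((K i : ℝ) - V₂ i / H) / (σ * Real.sqrt (V₂ i)))))
      =o[l] fun i => Real.sqrt (V₂ i)) ∧
    -- sharper expansion of the mean, upper extreme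
    ((∀ᶠ i in l, Real.log (V₂ i) ≤ R i) →
      (Irrational (Real.log p / Real.log (1 - p)) →
        Tendsto (fun i => (∫ ω, D i ω ∂P) - (V₂ i / H + H₂ / (2 * H ^ 2))) l (𝓝 0)) ∧
      (∀ d : ℝ, StoppedWalk.IsSpan p d →
        Tendsto (fun i => (∫ ω, D i ω ∂P) -
          (V₂ i / H + H₂ / (2 * H ^ 2) + StoppedWalk.oscillation p d (V₂ i))) l (𝓝 0))) ∧
    -- sharper expansion of the mean, lower extreme
    ((∀ᶠ i in l, R i ≤ -Real.log (V₂ i)) →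
      Tendsto (fun i => (∫ ω, D i ω ∂P) - ((K i : ℝ) + 1)) l (𝓝 0)) := by
  have h : IsLetterSeq P p ξ := ⟨hp0, hp1, hmeas, hindep, hlaw⟩
  have hHpos := entropy_pos hp0 hp1
  have hσpos : 0 < StoppedWalk.sigmaHat p := h.sigmaHat_pos hpq
  have ht : Tendsto V₂ l atTop := by
    have : V₂ = fun i => V i * Real.log 2 := funext hV₂
    rw [this]
    exact hV.atTop_mul_const (Real.log_pos one_lt_two)
  have hDs : D = fun i => stopped p ξ (V₂ i) (K i) := by
    ext i ω
    rw [hD, exitTime, stopped, hV₂, Nat.cast_min]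
  have hRs : R = fun i => normDeadline p (V₂ i) (K i) := by
    ext i
    rw [hR, normDeadline, hH]
  subst hDs hRs hH hH₂ hσ
  have hpos := ht.eventually_gt_atTop 0
  have hge := ht.eventually_ge_atTop 1
  have hmean := h.integral_stopped_isLittleO (K := K) ht
  refine ⟨?_, fun hRt => h.stopped_atTop hpq ht hRt, fun hRb => h.stopped_atBot ht hRb,
    fun a hRa => ⟨(h.stopped_nhds hpq ht hRa).1, fun z => ?_, (h.stopped_nhds hpq ht hRa).2, ?_⟩,
    ?_, ?_, fun hlate => ?_, fun hearly => ?_⟩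
  · exact Real.sqrt_pos.1 hσpos
  · rw [mul_min_of_nonneg _ _ hσpos.le, mul_div_cancel₀ _ hσpos.ne']
  · have hvar : Var[fun z : ℝ => min (sigmaHat p * z) a; gaussianReal 0 1] =
        sigmaHat p ^ 2 * Var[fun z : ℝ => min z (a / sigmaHat p); gaussianReal 0 1] := by
      rw [← variance_const_mul]
      congr 1
      ext z
      rw [mul_min_of_nonneg _ _ hσpos.le, mul_div_cancel₀ _ hσpos.ne']
    have := (h.stopped_nhds hpq ht hRa).2
    simp_rw [hvar, ← mul_assoc] at this
    exact this
  · refine hmean.congr_left fun i => ?_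
    have hx : (V₂ i / Real.binEntropy p - (K i : ℝ)) / (sigmaHat p * √(V₂ i)) =
        -normDeadline p (V₂ i) (K i) / sigmaHat p := by
      rw [normDeadline, ← neg_div, neg_sub, div_div, mul_comm]
    rw [integral_min_mul_gaussianReal' hσpos, hx]
    ring
  · refine hmean.congr' ?_ EventuallyEq.rfl
    -- Expanding around `K` uses `√V₂ · r = K - V₂ / H`, which needs `V₂ ≠ 0`; the expansion around
    -- `V₂ / H` holds for every index.
    filter_upwards [hpos] with i hi
    have hs : √(V₂ i) ≠ 0 := (Real.sqrt_pos.2 hi).ne'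
    have hx : ((K i : ℝ) - V₂ i / Real.binEntropy p) / (sigmaHat p * √(V₂ i)) =
        normDeadline p (V₂ i) (K i) / sigmaHat p := by
      rw [normDeadline, div_div, mul_comm]
    have hK' : √(V₂ i) * normDeadline p (V₂ i) (K i) = K i - V₂ i / Real.binEntropy p := by
      rw [normDeadline, mul_div_cancel₀ _ hs]
    rw [integral_min_mul_gaussianReal hσpos, hx, mul_sub, hK']
    ring
  · obtain ⟨r, hr, hrb⟩ := h.exists_meanPassage_sub_le
    have hdiff : Tendsto (fun i => meanPassage P p ξ (V₂ i)
        - ∫ ω, stopped p ξ (V₂ i) (K i) ω ∂P) l (𝓝 0) := by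
      refine squeeze_zero_norm' ?_ (hr.comp ht)
      filter_upwards [hge, hlate] with i hi hRi
      refine hrb _ hi _ ?_
      have hs : 0 < √(V₂ i) := Real.sqrt_pos.2 (by linarith)
      rw [normDeadline, le_div_iff₀ hs] at hRi
      linarith
    refine ⟨fun hirr => ?_, fun d hd => ?_⟩
    · have := (((h.tendsto_excess_of_irrational hirr).comp ht).sub hdiff).sub_const
        (secondMoment p / (2 * Real.binEntropy p ^ 2))
      rw [sub_zero, sub_self] at this
      refine this.congr fun i => ?_
      simp only [Function.comp_apply, IsLetterSeq.excess]
      ring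
    · have := (((h.tendsto_excess_of_isSpan hd).comp ht).sub hdiff).sub_const
        (secondMoment p / (2 * Real.binEntropy p ^ 2))
      rw [sub_zero, sub_self] at this
      refine this.congr fun i => ?_
      simp only [Function.comp_apply, IsLetterSeq.excess]
      ring
  · obtain ⟨r, hr, hrb⟩ := h.exists_deadline_sub_le
    refine squeeze_zero_norm' ?_ (hr.comp ht)
    -- Hoeffding's bound is taken at time `K` and needs at least one letter; this is where `K → ∞`
    -- enters.
    filter_upwards [hge, hearly, hK.eventually_gt_atTop 0] with i hi hRi hKi
    refine hrb _ hi _ hKi ?_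
    have hs : 0 < √(V₂ i) := Real.sqrt_pos.2 (by linarith)
    rw [normDeadline, div_le_iff₀ hs] at hRi
    linarith
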